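/- **Setting.** Fix a relation symbol $R$ of arity $n\ge 1$ whose first $l\le n$ positions form the primary key, an infinite domain of elements, and a set of variables. A *fact* (resp. *atom*) is $R(\bar t)$ with $\bar t$ an $n$-tuple of elements (resp. variables). For a fact or atom $t$, $\overline{\mathrm{key}}(t)$ is the tuple of its first $l$ entries, $\mathrm{key}(t)$ the set of these entries; $s\sim t$ (*key-equal*) means $\overline{\mathrm{key}}(s)=\overline{\mathrm{key}}(t)$. A *database* is a finite set of facts; its *blocks* are its classes under $\sim$; it is *consistent* if it has no two distinct key-equal facts; a *repair* of $D$ is a $\subseteq$-maximal consistent subset of $D$. A *query* $q=AB$ is a pair of atoms. For facts $a,b$ write $q(ab)$ if $a=\mu(A)$, $b=\mu(B)$ for some assignment $\mu$ of elements to variables, and $q\{ab\}$ for "$q(ab)$ or $q(ba)$". $D\models q$ if $q(ab)$ for some (not necessarily distinct) $a,b\in D$. The query is *2way-determined* if $\mathrm{key}(A)\not\subseteq\mathrm{key}(B)$, $\mathrm{key}(B)\not\subseteq\mathrm{key}(A)$, $\mathrm{key}(A)\subseteq\mathrm{vars}(B)$ and $\mathrm{key}(B)\subseteq\mathrm{vars}(A)$.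 * $D\models \mathsf{certain}(q)$ if every repair of $D$ satisfies $q$. * A *$k$-set* of $D$ is a set of at most $k$ facts contained in some repair of $D$. $\Delta_k(q,D)$ is the least set of $k$-sets that contains every $k$-set satisfying $q$ and contains a $k$-set $S$ whenever there is a block $B$ of $D$ such that each $u\in B$ has some $S'\subseteq S\cup\{u\}$ with $S'\in\Delta_k(q,D)$. $D\models\mathsf{Cert}_k(q)$ if $\emptyset\in\Delta_k(q,D)$. * The *solution graph* $G(D,q)$ has the facts of $D$ as vertices and an edge between $a$ and $b$ iff $q\{ab\}$. A connected component $C$ of it is a *quasi-clique* if all $a,b\in C$ with $a\not\sim b$ are adjacent. $D$ is a *clique-database* for $q$ if all components of $G(D,q)$ are quasi-cliques. For $a\in D$, $\mathrm{clique}(a)$ is the component of $a$ if that is a quasi-clique, and $\{a\}$ otherwise. $D\models\mathsf{Matching}(q)$ if the bipartite graph between the blocks of $D$ and the sets $\mathrm{clique}(a)$, $a\in D$, in which a block $B$ and a set $c$ are adjacent iff some $a\in B\cap c$ does not satisfy $q(aa)$, has a matching saturating all blocks. **Tripaths.** For facts $d,e,f$ with $q(de)$ and $q(ef)$, let $g(e)$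 be $\mathrm{key}(d)$ if $\mathrm{key}(d)\subseteq\mathrm{key}(e)$ and $\mathrm{key}(f)\not\subseteq\mathrm{key}(e)$; $\mathrm{key}(f)$ if $\mathrm{key}(d)\not\subseteq\mathrm{key}(e)$ and $\mathrm{key}(f)\subseteq\mathrm{key}(e)$; $\mathrm{key}(d)$ if $\mathrm{key}(d)\subseteq\mathrm{key}(f)\subseteq\mathrm{key}(e)$; $\mathrm{key}(f)$ if $\mathrm{key}(f)\subseteq\mathrm{key}(d)\subseteq\mathrm{key}(e)$; and $\mathrm{key}(e)$ in all remaining cases. A *tripath* of $q$ is a database $\Theta$ whose blocks can be arranged as a rooted tree with exactly two leaves such that: the root block $B_0$ consists of one fact $a(B_0)$, each leaf block $B_i$ ($i=1,2$) consists of one fact $b(B_i)$, and every other block $B$ consists of exactly two facts $a(B)\ne b(B)$; $q\{a(B)\,b(B')\}$ whenever $B$ is the parent of $B'$; and, for the branching block $B$ with its two children suitably named $B',B''$, the facts $d=b(B')$, $e=a(B)$, $f=b(B'')$ (the *center*) satisfy $q(de)$ and $q(ef)$, and $g(e)$ is contained in none of $\mathrm{key}(a(B_0))$, $\mathrm{key}(b(B_1))$,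 $\mathrm{key}(b(B_2))$. It is a *fork-tripath* if $q(fd)$ fails. A database *contains* a tripath if some subset of it is a tripath; $q$ *admits* a fork-tripath if some database contains one. **$q$-connected components.** Two blocks of $D$ are *$q$-connected* if they are related by the reflexive symmetric transitive closure of the relation "there are $a\in B_1$, $b\in B_2$ with $q\{ab\}$"; a *$q$-connected component* of $D$ is the union of an equivalence class of blocks. **Proposition.** Let $q$ be a 2way-determined query that does not admit a fork-tripath, and let $D$ be a database. Then the $q$-connected components $C_1,\dots,C_m$ of $D$ form a partition of $D$, and: 1. for every $i$, $C_i$ does not contain a tripath or $C_i$ is a clique-database for $q$; 2. $D\models\mathsf{certain}(q)$ if and only if $C_i\models\mathsf{certain}(q)$ for some $i$; 3. for every $k$, if $C_i\models\mathsf{Cert}_k(q)$ for some $i$, then $D\models\mathsf{Cert}_k(q)$; 4. if $D\models\mathsf{Matching}(q)$, then $C_i\models\mathsf{Matching}(q)$ for every $i$. -/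

import Mathlib

namespace TwoAtom

/-- A relational schema with one relation symbol `R` of arity `arity ≥ 1`, whose first `keyLen`
positions form the primary key. -/
structure Signature where
  arity : ℕ
  keyLen : ℕ
  arity_pos : 1 ≤ arity
  keyLen_le : keyLen ≤ arity

/-- A term `R(t)`: a fact if the entries are elements, an atom if they are variables. -/
abbrev Term (σ : Signature) (X : Type*) := Fin σ.arity → X

section Terms

variable {σ : Signature} {X : Type*}

/-- The key of a term as a tuple. -/
def keyTuple (t : Term σ X) : Fin σ.keyLen → X := fun i => t (Fin.castLE σ.keyLen_le i)

/-- The key of a term as a set. -/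
def keySet (t : Term σ X) : Set X := Set.range (keyTuple t)

/-- The set of all entries of a term (the variables of an atom, the active domain of a fact). -/
def entries (t : Term σ X) : Set X := Set.range t

/-- Two terms are key-equal if their key tuples coincide. -/
def KeyEq (s t : Term σ X) : Prop := keyTuple s = keyTuple t

instance [DecidableEq X] (s t : Term σ X) : Decidable (KeyEq s t) :=
  inferInstanceAs (Decidable (keyTuple s = keyTuple t))

end Terms

/-- A Boolean conjunctive query `q = AB` with two atoms over `R`. -/
structure Query (σ : Signature) (V : Type*) where
  A : Term σ V
  B : Term σ V

section Queries

variable {σ : Signature} {V α : Type*}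

/-- A query is 2way-determined if neither atom's key is contained in the other atom's key, but each
atom's key is contained in the variables of the other atom. -/
def Query.TwoWayDetermined (q : Query σ V) : Prop :=
  ¬ keySet q.A ⊆ keySet q.B ∧ ¬ keySet q.B ⊆ keySet q.A ∧
    keySet q.A ⊆ entries q.B ∧ keySet q.B ⊆ entries q.A

/-- `q(ab)`: the pair of facts `(a, b)` is `(μ(A), μ(B))` for an assignment `μ`. It is a solution
in every database that contains `a` and `b`. -/
def Query.Sol (q : Query σ V) (a b : Term σ α) : Prop :=
  ∃ μ : V → α, (fun i => μ (q.A i)) = a ∧ (fun i => μ (q.B i)) = b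

/-- `q{ab}`: `q(ab)` or `q(ba)`. -/
def Query.SymSol (q : Query σ V) (a b : Term σ α) : Prop := q.Sol a b ∨ q.Sol b a

/-- A database (a finite set of facts) satisfies `q` if it contains a solution. -/
def Query.Holds (q : Query σ V) (D : Finset (Term σ α)) : Prop :=
  ∃ a ∈ D, ∃ b ∈ D, q.Sol a b

/-- A database is consistent if it has no two distinct key-equal facts. -/
def Consistent (D : Finset (Term σ α)) : Prop :=
  ∀ a ∈ D, ∀ b ∈ D, KeyEq a b → a = b

/-- A repair of `D` is an inclusion-maximal consistent subset of `D`. -/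
def IsRepair (D r : Finset (Term σ α)) : Prop :=
  Maximal (fun s : Finset (Term σ α) => s ⊆ D ∧ Consistent s) r

/-- `D ⊨ certain(q)`: every repair of `D` satisfies `q`. -/
def Query.Certain (q : Query σ V) (D : Finset (Term σ α)) : Prop :=
  ∀ r : Finset (Term σ α), IsRepair D r → q.Holds r

/-- A `k`-set of `D`: at most `k` facts, extensible to a repair of `D`. -/
def IsKSet (k : ℕ) (D S : Finset (Term σ α)) : Prop :=
  S.card ≤ k ∧ ∃ r : Finset (Term σ α), IsRepair D r ∧ S ⊆ r

variable [DecidableEq α]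

/-- The set of blocks of `D` (its maximal subsets of pairwise key-equal facts). -/
def blocks (D : Finset (Term σ α)) : Finset (Finset (Term σ α)) :=
  D.image fun a => D.filter fun b => KeyEq a b

/-- The type of blocks of `D`. -/
abbrev Block (D : Finset (Term σ α)) := {B : Finset (Term σ α) // B ∈ blocks D}

/-! The greedy fixpoint algorithm -/

/-- The set `Δ_k(q, D)` computed by the greedy fixpoint algorithm: it initially contains the
`k`-sets that satisfy `q`, and a `k`-set `S` is added as soon as there is a block `B` such that each
`u ∈ B` has some `S' ⊆ S ∪ {u}` (here `next u`) in `Δ_k(q, D)`. -/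
inductive Query.Delta (q : Query σ V) (k : ℕ) (D : Finset (Term σ α)) :
    Finset (Term σ α) → Prop
  | init (S : Finset (Term σ α)) (hS : IsKSet k D S) (hq : q.Holds S) : Query.Delta q k D S
  | step (S B : Finset (Term σ α)) (hS : IsKSet k D S) (hB : B ∈ blocks D)
      (next : Term σ α → Finset (Term σ α)) (hsub : ∀ u ∈ B, next u ⊆ insert u S)
      (hnext : ∀ u ∈ B, Query.Delta q k D (next u)) : Query.Delta q k D S

/-- `D ⊨ Cert_k(q)`: the greedy fixpoint algorithm answers yes. -/
def Query.Cert (q : Query σ V) (k : ℕ) (D : Finset (Term σ α)) : Prop := q.Delta k D ∅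

/-! The matching algorithm -/

/-- The solution graph `G(D, q)`: distinct facts `a, b` of `D` are adjacent iff `q{ab}`. (Loops
matter neither for connected components nor for quasi-cliques.) -/
def Query.solutionGraph (q : Query σ V) (D : Finset (Term σ α)) :
    SimpleGraph {a : Term σ α // a ∈ D} :=
  SimpleGraph.fromRel fun a b => q.Sol a.1 b.1

/-- A connected component of the solution graph is a quasi-clique if any two of its facts that are
not key-equal are adjacent. -/
def Query.IsQuasiClique (q : Query σ V) {D : Finset (Term σ α)}
    (C : (q.solutionGraph D).ConnectedComponent) : Prop :=
  ∀ a ∈ C.supp, ∀ b ∈ C.supp, ¬ KeyEq a.1 b.1 → (q.solutionGraph D).Adj a b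

/-- `D` is a clique-database for `q` if every component of its solution graph is a quasi-clique. -/
def Query.IsCliqueDatabase (q : Query σ V) (D : Finset (Term σ α)) : Prop :=
  ∀ C : (q.solutionGraph D).ConnectedComponent, q.IsQuasiClique C

open Classical in
/-- `clique(a)`: the component of `a` in the solution graph if it is a quasi-clique, and `{a}`
otherwise. -/
noncomputable def Query.clique (q : Query σ V) (D : Finset (Term σ α))
    (a : {a : Term σ α // a ∈ D}) : Set {a : Term σ α // a ∈ D} :=
  if q.IsQuasiClique ((q.solutionGraph D).connectedComponentMk a) then
    ((q.solutionGraph D).connectedComponentMk a).supp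
  else {a}

/-- The right-hand vertices of the bipartite graph `H(D, q)`: the sets `clique(a)` for `a ∈ D`.
The left-hand vertices are the blocks of `D`. -/
abbrev Query.CliqueVertex (q : Query σ V) (D : Finset (Term σ α)) :=
  {c : Set {a : Term σ α // a ∈ D} // ∃ a, c = q.clique D a}

/-- The edges of `H(D, q)`: the block `B` is joined to `c` iff some fact `a ∈ B` lies in `c` and
`q(aa)` fails. -/
def Query.MatchEdge (q : Query σ V) (D : Finset (Term σ α)) (B : Block D)
    (c : q.CliqueVertex D) : Prop :=
  ∃ a : {a : Term σ α // a ∈ D}, a.1 ∈ B.1 ∧ a ∈ c.1 ∧ ¬ q.Sol a.1 a.1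

/-- `D ⊨ Matching(q)`: the graph `H(D, q)` has a matching that saturates the set of blocks. -/
def Query.Matching (q : Query σ V) (D : Finset (Term σ α)) : Prop :=
  ∃ m : Block D → q.CliqueVertex D, Function.Injective m ∧ ∀ B, q.MatchEdge D B (m B)

/-! Tripaths -/

open Classical in
/-- The tuple `g(e)` for a fact `e` that is branching with `d` and `f`. -/
noncomputable def gTuple (d e f : Term σ α) : Fin σ.keyLen → α :=
  if keySet d ⊆ keySet e ∧ ¬ keySet f ⊆ keySet e then keyTuple d
  else if ¬ keySet d ⊆ keySet e ∧ keySet f ⊆ keySet e then keyTuple f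
  else if keySet d ⊆ keySet f ∧ keySet f ⊆ keySet e then keyTuple d
  else if keySet f ⊆ keySet d ∧ keySet d ⊆ keySet e then keyTuple f
  else keyTuple e

/-- The set of elements of the tuple `g(e)`. -/
noncomputable def gSet (d e f : Term σ α) : Set α := Set.range (gTuple d e f)

/-- An arrangement of the database `Θ` as a tripath of `q`. -/
structure Tripath (q : Query σ V) (Θ : Finset (Term σ α)) where
  /-- the parent function on the blocks, undefined exactly at the root -/
  parent : Block Θ → Option (Block Θ)
  root : Block Θ
  parent_eq_none_iff : ∀ B, parent B = none ↔ B = root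
  reaches_root : ∀ B, Relation.ReflTransGen (fun B₁ B₂ => parent B₁ = some B₂) B root
  /-- the two leaves -/
  leaf₁ : Block Θ
  leaf₂ : Block Θ
  leaf_ne : leaf₁ ≠ leaf₂
  leaf_iff : ∀ B, (∀ B', parent B' ≠ some B) ↔ (B = leaf₁ ∨ B = leaf₂)
  /-- the facts `a(B)` (arbitrary at the leaves) and `b(B)` (arbitrary at the root) -/
  a : Block Θ → Term σ α
  b : Block Θ → Term σ α
  root_facts : root.1 = {a root}
  leaf₁_facts : leaf₁.1 = {b leaf₁}
  leaf₂_facts : leaf₂.1 = {b leaf₂}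
  inner_facts : ∀ B, B ≠ root → B ≠ leaf₁ → B ≠ leaf₂ → a B ≠ b B ∧ B.1 = {a B, b B}
  edge : ∀ B B', parent B' = some B → q.SymSol (a B) (b B')
  /-- the branching block and its two children, named so that the center is `d e f` -/
  branch : Block Θ
  childD : Block Θ
  childF : Block Θ
  child_ne : childD ≠ childF
  parent_childD : parent childD = some branch
  parent_childF : parent childF = some branch
  sol_de : q.Sol (b childD) (a branch)
  sol_ef : q.Sol (a branch) (b childF)
  not_subset_root : ¬ gSet (b childD) (a branch) (b childF) ⊆ keySet (a root)
  not_subset_leaf₁ : ¬ gSet (b childD) (a branch) (b childF) ⊆ keySet (b leaf₁)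
  not_subset_leaf₂ : ¬ gSet (b childD) (a branch) (b childF) ⊆ keySet (b leaf₂)

/-- The center `d e f` of a tripath is a fork: `q(fd)` fails. -/
def Tripath.IsFork {q : Query σ V} {Θ : Finset (Term σ α)} (T : Tripath q Θ) : Prop :=
  ¬ q.Sol (T.b T.childF) (T.b T.childD)

/-- `D` contains a tripath of `q`. -/
def Query.ContainsTripath (q : Query σ V) (D : Finset (Term σ α)) : Prop :=
  ∃ Θ ⊆ D, Nonempty (Tripath q Θ)

/-- `q` admits a fork-tripath, over the domain `α`. -/
def Query.AdmitsForkTripath (q : Query σ V) (α : Type*) [DecidableEq α] : Prop :=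
  ∃ D : Finset (Term σ α), ∃ Θ ⊆ D, ∃ T : Tripath q Θ, T.IsFork

/-! The `q`-connected components -/

/-- Two blocks of `D` are `q`-connected: they are related by the reflexive symmetric transitive
closure of the relation "some `a ∈ B₁`, `b ∈ B₂` satisfy `q{ab}`". -/
def Query.Connected (q : Query σ V) (D : Finset (Term σ α)) : Block D → Block D → Prop :=
  Relation.EqvGen fun B₁ B₂ => ∃ a ∈ B₁.1, ∃ b ∈ B₂.1, q.SymSol a b

open Classical in
/-- The `q`-connected component of a block: the union of all blocks `q`-connected to it. -/
noncomputable def Query.component (q : Query σ V) (D : Finset (Term σ α)) (B : Block D) :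
    Finset (Term σ α) :=
  (Finset.univ.filter fun B' : Block D => q.Connected D B B').biUnion fun B' => B'.1

/-- The set of `q`-connected components of `D`. -/
noncomputable def Query.components (q : Query σ V) (D : Finset (Term σ α)) :
    Finset (Finset (Term σ α)) :=
  Finset.univ.image (q.component D)

end Queries

end TwoAtom

namespace TwoAtom

/-! ### Saturated subsets and their solution graphs -/

section Basics

variable {σ : Signature} {V α : Type*}

/-! Items 2 to 4 hold because components are closed under key-equality and solutions
(`Query.Saturated`): repairs restrict to them, their blocks, `k`-sets and cliques are also those of
the database, and falsifying repairs of all components unite to a falsifying repair.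

Item 1 is the core. If all centers `d e f` in a component are triangles, its solution graph splits
into quasi-cliques (`Query.isCliqueDatabase_of_triangles`). So suppose that a component contains a
tripath, necessarily with a triangle as center, and also a center that is no triangle. A
fork-tripath is then built (`exists_forkArms`). From each fact of the fork center a chain of
solutions leads to the triangle and can circle it forever. These three arms have the shape of a
tripath, but keys may repeat, the two facts of a block may coincide, and the ends may contain
`g(e)`. Every entry is therefore replaced by a tuple of labels. As long as all coordinates follow
the same directions, solutions remain solutions, and extra coordinates remove each coincidence.

The extra labels come from linear algebra. The root of the tripath misses some `p` in the key of
`e`. The indicator of `p` with values in `ZMod 2` turns the connection from root to triangle into a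
chain of keys from zero to a nonzero periodic line. Over a group the key relation is a subgroup, so
its powers are difunctional, and the zigzag chain can be straightened (`relPow_of_strip`) to a line
that runs from zero to the periodic labelling; subtraction gives a line back to zero. Read along an
arm with arbitrary directions, such lines give labels that are zero up to a prescribed step and
nonzero right after it (`exists_fresh_arm`), and labels that show `p` at the center but vanish at
the ends. An infinite domain has room for all these tuples. -/

theorem KeyEq.symm {s t : Term σ α} (h : KeyEq s t) : KeyEq t s := Eq.symm h

theorem KeyEq.trans {s t u : Term σ α} (h : KeyEq s t) (h' : KeyEq t u) : KeyEq s u :=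
  Eq.trans h h'

theorem Query.SymSol.symm {q : Query σ V} {a b : Term σ α} (h : q.SymSol a b) : q.SymSol b a :=
  Or.symm h

/-- Maximality in local form: meeting every block is a condition that restricts to components and
survives unions. -/
theorem isRepair_iff {D r : Finset (Term σ α)} :
    IsRepair D r ↔ r ⊆ D ∧ Consistent r ∧ ∀ a ∈ D, ∃ b ∈ r, KeyEq a b := by
  classical
  constructor
  · rintro ⟨⟨hrD, hc⟩, hmax⟩
    refine ⟨hrD, hc, fun a ha => ?_⟩
    by_contra! hno
    have hins : insert a r ⊆ r := by
      refine hmax ⟨Finset.insert_subset ha hrD, ?_⟩ (Finset.subset_insert _ _)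
      intro x hx y hy hxy
      rcases Finset.mem_insert.1 hx with rfl | hx' <;>
        rcases Finset.mem_insert.1 hy with rfl | hy'
      · rfl
      · exact absurd hxy (hno y hy')
      · exact absurd hxy.symm (hno x hx')
      · exact hc x hx' y hy' hxy
    exact hno a (hins (Finset.mem_insert_self _ _)) rfl
  · rintro ⟨hrD, hc, hall⟩
    refine ⟨⟨hrD, hc⟩, fun s ⟨hsD, hs⟩ hrs x hx => ?_⟩
    obtain ⟨b, hb, hxb⟩ := hall x (hsD hx)
    rwa [hs x hx b (hrs hb) hxb]

theorem Consistent.exists_repair {D s : Finset (Term σ α)} (hsD : s ⊆ D) (hs : Consistent s) :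
    ∃ r, IsRepair D r ∧ s ⊆ r := by
  classical
  have hfin : Set.Finite {t : Finset (Term σ α) | t ⊆ D ∧ Consistent t} :=
    (D.powerset.finite_toSet).subset fun t ht => by simpa using ht.1
  obtain ⟨r, hsr, hr⟩ := hfin.exists_le_maximal (a := s) ⟨hsD, hs⟩
  exact ⟨r, hr, hsr⟩

/-- `C` is a subset of `D` that is closed under key-equality and solutions. -/
structure Query.Saturated (q : Query σ V) (D C : Finset (Term σ α)) : Prop where
  subset : C ⊆ D
  keyEq : ∀ a ∈ C, ∀ b ∈ D, KeyEq a b → b ∈ C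
  symSol : ∀ a ∈ C, ∀ b ∈ D, q.SymSol a b → b ∈ C

theorem Query.Saturated.isKSet {q : Query σ V} {D C S : Finset (Term σ α)} {k : ℕ}
    (hC : q.Saturated D C) (hS : IsKSet k C S) : IsKSet k D S := by
  obtain ⟨hcard, r, hr, hSr⟩ := hS
  rw [isRepair_iff] at hr
  obtain ⟨r', hr', hrr'⟩ := Consistent.exists_repair (hr.1.trans hC.subset) hr.2.1
  exact ⟨hcard, r', hr', hSr.trans hrr'⟩

theorem Query.solutionGraph_adj {q : Query σ V} {D : Finset (Term σ α)}
    {a b : {a : Term σ α // a ∈ D}} :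
    (q.solutionGraph D).Adj a b ↔ a ≠ b ∧ q.SymSol a.1 b.1 := SimpleGraph.fromRel_adj _ _ _

/-- The inclusion of a subset of a database, on facts. -/
def inclusion {D C : Finset (Term σ α)} (h : C ⊆ D) (a : {a : Term σ α // a ∈ C}) :
    {a : Term σ α // a ∈ D} := ⟨a.1, h a.2⟩

theorem inclusion_injective {D C : Finset (Term σ α)} (h : C ⊆ D) :
    Function.Injective (inclusion h) := fun _ _ e => Subtype.ext (congrArg (fun x => x.1) e)

theorem Query.clique_eq_of_mem {q : Query σ V} {D : Finset (Term σ α)}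
    {a b : {a : Term σ α // a ∈ D}} (h : b ∈ q.clique D a) : q.clique D b = q.clique D a := by
  by_cases hq : q.IsQuasiClique ((q.solutionGraph D).connectedComponentMk a)
  · rw [Query.clique, if_pos hq, SimpleGraph.ConnectedComponent.mem_supp_iff] at h
    unfold Query.clique
    rw [h, if_pos hq, if_pos hq]
  · rw [Query.clique, if_neg hq, Set.mem_singleton_iff] at h
    rw [h]

theorem Query.mem_clique_self {q : Query σ V} {D : Finset (Term σ α)}
    (a : {a : Term σ α // a ∈ D}) : a ∈ q.clique D a := by
  unfold Query.clique
  split_ifs <;> simp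

theorem adj_inclusion {q : Query σ V} {D C : Finset (Term σ α)} (h : C ⊆ D)
    {a b : {a : Term σ α // a ∈ C}} :
    (q.solutionGraph D).Adj (inclusion h a) (inclusion h b) ↔ (q.solutionGraph C).Adj a b := by
  rw [Query.solutionGraph_adj, Query.solutionGraph_adj, (inclusion_injective h).ne_iff]
  rfl

/-- A path that starts in `C` never leaves it, because `C` is closed under solutions. -/
theorem Query.Saturated.reachable {q : Query σ V} {D C : Finset (Term σ α)}
    (hC : q.Saturated D C) {a : {a : Term σ α // a ∈ C}} {y : {a : Term σ α // a ∈ D}} :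
    (q.solutionGraph D).Reachable (inclusion hC.subset a) y ↔
      ∃ b, inclusion hC.subset b = y ∧ (q.solutionGraph C).Reachable a b := by
  constructor
  · rw [SimpleGraph.reachable_iff_reflTransGen]
    intro h
    induction h with
    | refl => exact ⟨a, rfl, .refl _⟩
    | tail _ hbc ih =>
      obtain ⟨b, rfl, hb⟩ := ih
      rename_i c _
      have hcC := hC.symSol b.1 b.2 c.1 c.2 (Query.solutionGraph_adj.1 hbc).2
      refine ⟨⟨c.1, hcC⟩, rfl, hb.trans (SimpleGraph.Adj.reachable ?_)⟩
      exact (adj_inclusion hC.subset).1 hbc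
  · rintro ⟨b, rfl, h⟩
    exact h.map ⟨inclusion hC.subset, fun h => (adj_inclusion hC.subset).2 h⟩

theorem Query.Saturated.supp {q : Query σ V} {D C : Finset (Term σ α)}
    (hC : q.Saturated D C) (a : {a : Term σ α // a ∈ C}) :
    ((q.solutionGraph D).connectedComponentMk (inclusion hC.subset a)).supp =
      inclusion hC.subset '' ((q.solutionGraph C).connectedComponentMk a).supp := by
  ext y
  rw [SimpleGraph.ConnectedComponent.mem_supp_iff, SimpleGraph.ConnectedComponent.eq,
    SimpleGraph.reachable_comm, hC.reachable]
  refine exists_congr fun b => ?_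
  rw [SimpleGraph.ConnectedComponent.mem_supp_iff, SimpleGraph.ConnectedComponent.eq,
    SimpleGraph.reachable_comm (u := b), and_comm]

theorem Query.Saturated.isQuasiClique_iff {q : Query σ V} {D C : Finset (Term σ α)}
    (hC : q.Saturated D C) (a : {a : Term σ α // a ∈ C}) :
    q.IsQuasiClique ((q.solutionGraph D).connectedComponentMk (inclusion hC.subset a)) ↔
      q.IsQuasiClique ((q.solutionGraph C).connectedComponentMk a) := by
  unfold Query.IsQuasiClique
  rw [hC.supp]
  simp only [Set.forall_mem_image, adj_inclusion]
  rfl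

theorem Query.Saturated.clique {q : Query σ V} {D C : Finset (Term σ α)}
    (hC : q.Saturated D C) (a : {a : Term σ α // a ∈ C}) :
    q.clique D (inclusion hC.subset a) = inclusion hC.subset '' q.clique C a := by
  unfold Query.clique
  by_cases h : q.IsQuasiClique ((q.solutionGraph C).connectedComponentMk a)
  · rw [if_pos h, if_pos ((hC.isQuasiClique_iff a).2 h), hC.supp]
  · rw [if_neg h, if_neg (mt (hC.isQuasiClique_iff a).1 h), Set.image_singleton]

/-! ### Blocks and the partition into components -/

variable [DecidableEq α]

/-- The block of a fact of `D`. -/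
def blockOf (D : Finset (Term σ α)) (a : Term σ α) (ha : a ∈ D) : Block D :=
  ⟨D.filter fun b => KeyEq a b, Finset.mem_image_of_mem _ ha⟩

theorem mem_blockOf {D : Finset (Term σ α)} {a x : Term σ α} (ha : a ∈ D) :
    x ∈ (blockOf D a ha).1 ↔ x ∈ D ∧ KeyEq a x := Finset.mem_filter

theorem self_mem_blockOf {D : Finset (Term σ α)} {a : Term σ α} (ha : a ∈ D) :
    a ∈ (blockOf D a ha).1 := (mem_blockOf ha).2 ⟨ha, rfl⟩

theorem exists_eq_blockOf {D : Finset (Term σ α)} (B : Block D) :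
    ∃ a, ∃ ha : a ∈ D, B = blockOf D a ha := by
  obtain ⟨a, ha, h⟩ := Finset.mem_image.1 B.2
  exact ⟨a, ha, Subtype.ext h.symm⟩

theorem Block.mem_of_mem {D : Finset (Term σ α)} (B : Block D) {a : Term σ α} (ha : a ∈ B.1) :
    a ∈ D := by
  obtain ⟨b, hb, rfl⟩ := exists_eq_blockOf B
  exact ((mem_blockOf hb).1 ha).1

theorem Block.eq_blockOf {D : Finset (Term σ α)} (B : Block D) {a : Term σ α} (ha : a ∈ B.1) :
    B = blockOf D a (B.mem_of_mem ha) := by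
  obtain ⟨b, hb, rfl⟩ := exists_eq_blockOf B
  apply Subtype.ext
  ext x
  have hab := ((mem_blockOf hb).1 ha).2
  rw [mem_blockOf, mem_blockOf]
  exact ⟨fun h => ⟨h.1, hab.symm.trans h.2⟩, fun h => ⟨h.1, hab.trans h.2⟩⟩

theorem blockOf_eq_iff {D : Finset (Term σ α)} {a b : Term σ α} (ha : a ∈ D) (hb : b ∈ D) :
    blockOf D a ha = blockOf D b hb ↔ KeyEq a b := by
  constructor
  · intro h
    have := self_mem_blockOf hb
    rw [← h] at this
    exact ((mem_blockOf ha).1 this).2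
  · intro h
    exact ((blockOf D a ha).eq_blockOf ((mem_blockOf ha).2 ⟨hb, h⟩))

theorem Block.keyEq {D : Finset (Term σ α)} (B : Block D) {a b : Term σ α} (ha : a ∈ B.1)
    (hb : b ∈ B.1) : KeyEq a b := by
  rw [← blockOf_eq_iff (B.mem_of_mem ha) (B.mem_of_mem hb), ← B.eq_blockOf ha, ← B.eq_blockOf hb]

theorem Query.mem_component {q : Query σ V} {D : Finset (Term σ α)} {B : Block D}
    {x : Term σ α} :
    x ∈ q.component D B ↔ ∃ hx : x ∈ D, q.Connected D B (blockOf D x hx) := by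
  classical
  simp only [Query.component, Finset.mem_biUnion, Finset.mem_filter, Finset.mem_univ, true_and]
  constructor
  · rintro ⟨B', h, hx⟩
    exact ⟨B'.mem_of_mem hx, B'.eq_blockOf hx ▸ h⟩
  · rintro ⟨hx, h⟩
    exact ⟨_, h, self_mem_blockOf hx⟩

theorem Query.saturated_component (q : Query σ V) (D : Finset (Term σ α)) (B : Block D) :
    q.Saturated D (q.component D B) where
  subset x hx := (Query.mem_component.1 hx).1
  keyEq a ha b hb hab := by
    obtain ⟨haD, h⟩ := Query.mem_component.1 ha
    exact Query.mem_component.2 ⟨hb, (blockOf_eq_iff haD hb).2 hab ▸ h⟩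
  symSol a ha b hb hab := by
    obtain ⟨haD, h⟩ := Query.mem_component.1 ha
    exact Query.mem_component.2 ⟨hb, h.trans _ _ _
      (.rel _ _ ⟨a, self_mem_blockOf haD, b, self_mem_blockOf hb, hab⟩)⟩

theorem Query.component_eq_of_mem {q : Query σ V} {D : Finset (Term σ α)} {B : Block D}
    {x : Term σ α} (hx : x ∈ q.component D B) :
    q.component D B = q.component D (blockOf D x (Query.mem_component.1 hx).1) := by
  obtain ⟨hxD, h⟩ := Query.mem_component.1 hx
  ext y
  simp only [Query.mem_component]
  exact exists_congr fun hy => ⟨fun h' => (h.symm _ _).trans _ _ _ h', fun h' => h.trans _ _ _ h'⟩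

/-- The partition of `D` into its `q`-connected components. -/
noncomputable def Query.componentPartition (q : Query σ V) (D : Finset (Term σ α)) :
    Finpartition D where
  parts := q.components D
  supIndep := by
    rw [Finset.supIndep_iff_pairwiseDisjoint]
    intro C hC C' hC' hne
    obtain ⟨B, -, rfl⟩ := Finset.mem_image.1 hC
    obtain ⟨B', -, rfl⟩ := Finset.mem_image.1 hC'
    refine Finset.disjoint_left.2 fun x hx hx' => hne ?_
    exact (Query.component_eq_of_mem hx).trans (Query.component_eq_of_mem hx').symm
  sup_parts := by
    apply Finset.Subset.antisymm
    · refine Finset.sup_le fun C hC => ?_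
      obtain ⟨B, -, rfl⟩ := Finset.mem_image.1 hC
      exact (q.saturated_component D B).subset
    · intro x hx
      refine Finset.mem_sup.2 ⟨q.component D (blockOf D x hx),
        Finset.mem_image_of_mem _ (Finset.mem_univ _), ?_⟩
      exact Query.mem_component.2 ⟨hx, .refl _⟩
  bot_notMem := by
    intro h
    obtain ⟨B, -, hB⟩ := Finset.mem_image.1 h
    obtain ⟨a, ha, rfl⟩ := exists_eq_blockOf B
    have : a ∈ q.component D (blockOf D a ha) := Query.mem_component.2 ⟨ha, .refl _⟩
    rw [hB] at this
    exact absurd this (Finset.notMem_empty a)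

theorem Query.saturated_of_mem_components {q : Query σ V} {D C : Finset (Term σ α)}
    (hC : C ∈ q.components D) : q.Saturated D C := by
  obtain ⟨B, -, rfl⟩ := Finset.mem_image.1 hC
  exact q.saturated_component D B

/-! ### Repairs, the fixpoint algorithm and matchings on components -/

theorem Query.Saturated.isRepair_filter {q : Query σ V} {D C r : Finset (Term σ α)}
    (hC : q.Saturated D C) (hr : IsRepair D r) : IsRepair C (r.filter (· ∈ C)) := by
  rw [isRepair_iff] at hr ⊢
  refine ⟨fun x hx => (Finset.mem_filter.1 hx).2, fun a ha b hb =>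
    hr.2.1 a (Finset.mem_filter.1 ha).1 b (Finset.mem_filter.1 hb).1, fun a ha => ?_⟩
  obtain ⟨b, hb, hab⟩ := hr.2.2 a (hC.subset ha)
  exact ⟨b, Finset.mem_filter.2 ⟨hb, hC.keyEq a ha b (hr.1 hb) hab⟩, hab⟩

theorem Query.Saturated.certain {q : Query σ V} {D C : Finset (Term σ α)}
    (hC : q.Saturated D C) (h : q.Certain C) : q.Certain D := by
  intro r hr
  obtain ⟨a, ha, b, hb, hab⟩ := h _ (hC.isRepair_filter hr)
  exact ⟨a, (Finset.mem_filter.1 ha).1, b, (Finset.mem_filter.1 hb).1, hab⟩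

/-- Neither key-equality nor a solution crosses between components, so the union of one falsifying
repair per component is a falsifying repair. -/
theorem Query.certain_iff (q : Query σ V) (D : Finset (Term σ α)) :
    q.Certain D ↔ ∃ C ∈ q.components D, q.Certain C := by
  constructor
  · contrapose!
    intro h
    have h' : ∀ C : Finset (Term σ α), ∃ r, C ∈ q.components D → IsRepair C r ∧ ¬ q.Holds r := by
      intro C
      by_cases hC : C ∈ q.components D
      · have := h C hC
        unfold Query.Certain at this
        push Not at this
        obtain ⟨r, hr⟩ := this
        exact ⟨r, fun _ => hr⟩
      · exact ⟨∅, fun h => absurd h hC⟩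
    choose r hr using h'
    have hmem : ∀ x ∈ D, ∃ C ∈ q.components D, x ∈ C := fun x hx =>
      (q.componentPartition D).exists_mem hx
    have huniq : ∀ C ∈ q.components D, ∀ C' ∈ q.components D, ∀ x ∈ C, x ∈ C' → C = C' :=
      fun C hC C' hC' x hx hx' => (q.componentPartition D).eq_of_mem_parts hC hC' hx hx'
    intro hD
    have hrep : IsRepair D ((q.components D).biUnion r) := by
      rw [isRepair_iff]
      refine ⟨?_, ?_, ?_⟩
      · intro x hx
        obtain ⟨C, hC, hx⟩ := Finset.mem_biUnion.1 hx
        exact (Query.saturated_of_mem_components hC).subset ((isRepair_iff.1 (hr C hC).1).1 hx)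
      · intro a ha b hb hab
        obtain ⟨C, hC, ha⟩ := Finset.mem_biUnion.1 ha
        obtain ⟨C', hC', hb⟩ := Finset.mem_biUnion.1 hb
        have hrC := isRepair_iff.1 (hr C hC).1
        have hbC' := (isRepair_iff.1 (hr C' hC').1).1 hb
        have hbC : b ∈ C := (Query.saturated_of_mem_components hC).keyEq a (hrC.1 ha) b
          ((Query.saturated_of_mem_components hC').subset hbC') hab
        obtain rfl := huniq C hC C' hC' b hbC hbC'
        exact hrC.2.1 a ha b hb hab
      · intro a ha
        obtain ⟨C, hC, haC⟩ := hmem a ha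
        obtain ⟨b, hb, hab⟩ := (isRepair_iff.1 (hr C hC).1).2.2 a haC
        exact ⟨b, Finset.mem_biUnion.2 ⟨C, hC, hb⟩, hab⟩
    obtain ⟨a, ha, b, hb, hab⟩ := hD _ hrep
    obtain ⟨C, hC, ha⟩ := Finset.mem_biUnion.1 ha
    obtain ⟨C', hC', hb⟩ := Finset.mem_biUnion.1 hb
    have haC := (isRepair_iff.1 (hr C hC).1).1 ha
    have hbC' := (isRepair_iff.1 (hr C' hC').1).1 hb
    have hbC : b ∈ C := (Query.saturated_of_mem_components hC).symSol a haC b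
      ((Query.saturated_of_mem_components hC').subset hbC') (Or.inl hab)
    obtain rfl := huniq C hC C' hC' b hbC hbC'
    exact (hr C hC).2 ⟨a, ha, b, hb, hab⟩
  · rintro ⟨C, hC, h⟩
    exact (Query.saturated_of_mem_components hC).certain h

theorem Query.Saturated.blockOf_val {q : Query σ V} {D C : Finset (Term σ α)}
    (hC : q.Saturated D C) {a : Term σ α} (ha : a ∈ C) :
    (blockOf C a ha).1 = (blockOf D a (hC.subset ha)).1 := by
  ext x
  rw [mem_blockOf, mem_blockOf]
  exact ⟨fun h => ⟨hC.subset h.1, h.2⟩, fun h => ⟨hC.keyEq a ha x h.1 h.2, h.2⟩⟩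

theorem Query.Saturated.mem_blocks {q : Query σ V} {D C : Finset (Term σ α)}
    (hC : q.Saturated D C) {B : Finset (Term σ α)} (hB : B ∈ blocks C) : B ∈ blocks D := by
  obtain ⟨a, ha, h⟩ := exists_eq_blockOf (⟨B, hB⟩ : Block C)
  have : B = (blockOf D a (hC.subset ha)).1 := by rw [← hC.blockOf_val ha, ← h]
  rw [this]
  exact (blockOf D a _).2

theorem Query.Saturated.delta {q : Query σ V} {D C : Finset (Term σ α)} {k : ℕ}
    (hC : q.Saturated D C) {S : Finset (Term σ α)} (h : q.Delta k C S) : q.Delta k D S := by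
  induction h with
  | init S hS hq => exact .init S (hC.isKSet hS) hq
  | step S B hS hB next hsub _ ih => exact .step S B (hC.isKSet hS) (hC.mem_blocks hB) next hsub ih

theorem Query.Saturated.cert {q : Query σ V} {D C : Finset (Term σ α)} {k : ℕ}
    (hC : q.Saturated D C) (h : q.Cert k C) : q.Cert k D := hC.delta h

/-- The partner in `D` of a block of `C` is the clique of a fact of `C`, hence the image of a clique
of `C`. That clique determines the partner, which gives injectivity. -/
theorem Query.Saturated.matching {q : Query σ V} {D C : Finset (Term σ α)}
    (hC : q.Saturated D C) (h : q.Matching D) : q.Matching C := by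
  obtain ⟨m, hinj, hedge⟩ := h
  have key : ∀ B : Block C, ∃ a : {a : Term σ α // a ∈ C}, a.1 ∈ B.1 ∧ ¬ q.Sol a.1 a.1 ∧
      (m ⟨B.1, hC.mem_blocks B.2⟩).1 = inclusion hC.subset '' q.clique C a := by
    intro B
    obtain ⟨a, haB, hac, hs⟩ := hedge ⟨B.1, hC.mem_blocks B.2⟩
    refine ⟨⟨a.1, B.mem_of_mem haB⟩, haB, hs, ?_⟩
    rw [← hC.clique]
    obtain ⟨a', ha'⟩ := (m ⟨B.1, hC.mem_blocks B.2⟩).2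
    rw [ha'] at hac ⊢
    exact (Query.clique_eq_of_mem hac).symm
  choose a ha hs hm using key
  refine ⟨fun B => ⟨q.clique C (a B), a B, rfl⟩, fun B B' hBB' => ?_, fun B =>
    ⟨a B, ha B, Query.mem_clique_self _, hs B⟩⟩
  have h1 : q.clique C (a B) = q.clique C (a B') := congrArg Subtype.val hBB'
  have h2 : m ⟨B.1, hC.mem_blocks B.2⟩ = m ⟨B'.1, hC.mem_blocks B'.2⟩ := by
    apply Subtype.ext
    rw [hm, hm, h1]
  exact Subtype.ext (Subtype.mk.inj (hinj h2))

end Basics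

/-! ### Solutions as equality patterns; components all of whose centers are triangles -/

section Solutions

variable {σ : Signature} {V α : Type*}

theorem Query.sol_iff {q : Query σ V} {a b : Term σ α} :
    q.Sol a b ↔ (∀ i j, q.A i = q.A j → a i = a j) ∧ (∀ i j, q.A i = q.B j → a i = b j) ∧
      (∀ i j, q.B i = q.B j → b i = b j) := by
  classical
  constructor
  · rintro ⟨μ, rfl, rfl⟩
    exact ⟨fun i j h => congrArg μ h, fun i j h => congrArg μ h, fun i j h => congrArg μ h⟩
  · rintro ⟨hA, hAB, hB⟩
    -- Needed as a value for variables that occur in neither atom.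
    have : Nonempty α := ⟨a ⟨0, σ.arity_pos⟩⟩
    refine ⟨fun v => if h : ∃ i, q.A i = v then a h.choose
      else if h : ∃ i, q.B i = v then b h.choose else Classical.arbitrary α, ?_, ?_⟩
    · funext i
      have h : ∃ j, q.A j = q.A i := ⟨i, rfl⟩
      simp only [dif_pos h]
      exact hA _ _ h.choose_spec
    · funext i
      have h' : ∃ j, q.B j = q.B i := ⟨i, rfl⟩
      by_cases h : ∃ j, q.A j = q.B i
      · simp only [dif_pos h]
        exact hAB _ _ h.choose_spec
      · simp only [dif_neg h, dif_pos h']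
        exact hB _ _ h'.choose_spec

/-- The relation of being a solution is difunctional. -/
theorem Query.Sol.difunctional {q : Query σ V} {a b a' b' : Term σ α} (h₁ : q.Sol a b)
    (h₂ : q.Sol a' b) (h₃ : q.Sol a' b') : q.Sol a b' := by
  rw [Query.sol_iff] at *
  refine ⟨h₁.1, fun i j h => ?_, h₃.2.2⟩
  exact (h₁.2.1 i j h).trans ((h₂.2.1 i j h).symm.trans (h₃.2.1 i j h))

theorem Query.Sol.map {q : Query σ V} {β : Type*} {a b : Term σ α} (h : q.Sol a b) (f : α → β) :
    q.Sol (fun i => f (a i)) (fun i => f (b i)) := by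
  obtain ⟨μ, rfl, rfl⟩ := h
  exact ⟨f ∘ μ, rfl, rfl⟩

/-- The key variables of `B` occur in `A`, so the first fact of a solution fixes the key of the
second. -/
theorem Query.TwoWayDetermined.keyEq_right {q : Query σ V} (hq : q.TwoWayDetermined)
    {a b c : Term σ α} (hb : q.Sol a b) (hc : q.Sol a c) : KeyEq b c := by
  rw [Query.sol_iff] at hb hc
  funext i
  obtain ⟨j, hj⟩ := hq.2.2.2 ⟨i, rfl⟩
  exact (hb.2.1 j _ hj).symm.trans (hc.2.1 j _ hj)

theorem Query.TwoWayDetermined.keyEq_left {q : Query σ V} (hq : q.TwoWayDetermined)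
    {a b c : Term σ α} (hb : q.Sol b a) (hc : q.Sol c a) : KeyEq b c := by
  rw [Query.sol_iff] at hb hc
  funext i
  obtain ⟨j, hj⟩ := hq.2.2.1 ⟨i, rfl⟩
  exact (hb.2.1 _ j hj.symm).trans (hc.2.1 _ j hj.symm).symm

/-- If all centers in `C` are triangles, then `C` is a clique-database. -/
theorem Query.isCliqueDatabase_of_triangles {q : Query σ V} (hq : q.TwoWayDetermined)
    {C : Finset (Term σ α)}
    (h : ∀ d ∈ C, ∀ e ∈ C, ∀ f ∈ C, q.Sol d e → q.Sol e f → q.Sol f d) :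
    q.IsCliqueDatabase C := by
  -- These five alternatives are stable under one more edge, by the triangle hypothesis and
  -- difunctionality. The last two make `a` and `b` key-equal.
  have key : ∀ a b : {a : Term σ α // a ∈ C}, (q.solutionGraph C).Reachable a b →
      q.Sol a.1 b.1 ∨ q.Sol b.1 a.1 ∨ b = a ∨
        (∃ y ∈ C, q.Sol a.1 y ∧ q.Sol b.1 y) ∨ ∃ y ∈ C, q.Sol y a.1 ∧ q.Sol y b.1 := by
    intro a b hab
    rw [SimpleGraph.reachable_iff_reflTransGen] at hab
    induction hab with
    | refl => exact .inr (.inr (.inl rfl))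
    | tail _ hbc ih =>
      rename_i b c _
      have ha := a.2
      have hb := b.2
      have hc := c.2
      rcases (Query.solutionGraph_adj.1 hbc).2 with hbc | hbc <;>
        rcases ih with ih | ih | rfl | ⟨y, hy, hay, hby⟩ | ⟨y, hy, hay, hby⟩
      · exact .inr (.inl (h _ ha _ hb _ hc ih hbc))
      · exact .inr (.inr (.inr (.inr ⟨b, hb, ih, hbc⟩)))
      · exact .inl hbc
      · exact .inl (hay.difunctional hby hbc)
      · exact .inl (h _ hc _ hy _ ha (h _ hy _ hb _ hc hby hbc) hay)
      · exact .inr (.inr (.inr (.inl ⟨b, hb, ih, hbc⟩)))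
      · exact .inl (h _ hc _ hb _ ha hbc ih)
      · exact .inr (.inl hbc)
      · exact .inr (.inl (h _ ha _ hy _ hc hay (h _ hc _ hb _ hy hbc hby)))
      · exact .inr (.inl (hbc.difunctional hby hay))
  intro K a ha b hb hne
  rw [SimpleGraph.ConnectedComponent.mem_supp_iff] at ha hb
  have hab := key a b (SimpleGraph.ConnectedComponent.exact (ha.trans hb.symm))
  refine Query.solutionGraph_adj.2 ⟨fun e => hne (by rw [e]; rfl), ?_⟩
  rcases hab with h1 | h1 | rfl | ⟨y, _, h1, h2⟩ | ⟨y, _, h1, h2⟩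
  · exact .inl h1
  · exact .inr h1
  · exact absurd rfl hne
  · exact absurd (hq.keyEq_left h1 h2) hne
  · exact absurd (hq.keyEq_right h1 h2) hne

end Solutions

/-! ### Straightening zigzag walks -/

section Strips

variable {Γ : Type*}

/-- `RelPow R n` is the `n`-fold composition of the relation `R` with itself. -/
def RelPow (R : Γ → Γ → Prop) : ℕ → Γ → Γ → Prop
  | 0, x, y => x = y
  | n + 1, x, y => ∃ z, R x z ∧ RelPow R n z y

theorem RelPow.snoc {R : Γ → Γ → Prop} {n : ℕ} {x y z : Γ} (h : RelPow R n x y) (hyz : R y z) :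
    RelPow R (n + 1) x z := by
  induction n generalizing x with
  | zero => exact ⟨z, (show x = y from h) ▸ hyz, rfl⟩
  | succ n ih => obtain ⟨w, hxw, hw⟩ := h; exact ⟨w, hxw, ih hw⟩

theorem RelPow.unsnoc {R : Γ → Γ → Prop} {n : ℕ} {x z : Γ} (h : RelPow R (n + 1) x z) :
    ∃ y, RelPow R n x y ∧ R y z := by
  induction n generalizing x with
  | zero => obtain ⟨w, hxw, hw⟩ := h; exact ⟨x, rfl, (show w = z from hw) ▸ hxw⟩
  | succ n ih =>
    obtain ⟨w, hxw, hw⟩ := h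
    obtain ⟨y, hy, hyz⟩ := ih hw
    exact ⟨y, ⟨w, hxw, hy⟩, hyz⟩

theorem RelPow.exists_seq {R : Γ → Γ → Prop} {n : ℕ} {x y : Γ} (h : RelPow R n x y) :
    ∃ k : ℕ → Γ, k 0 = x ∧ k n = y ∧ ∀ i < n, R (k i) (k (i + 1)) := by
  induction n generalizing x with
  | zero => exact ⟨fun _ => x, rfl, h, fun i hi => absurd hi (Nat.not_lt_zero i)⟩
  | succ n ih =>
    obtain ⟨z, hxz, hz⟩ := h
    obtain ⟨k, h0, hn, hk⟩ := ih hz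
    refine ⟨fun i => Nat.casesOn i x k, rfl, hn, fun i hi => ?_⟩
    cases i with
    | zero =>
      change R x (k 0)
      rwa [h0]
    | succ i => exact hk i (by omega)

/-- A walk along a relation with difunctional powers that stays between the levels of its ends is
as good as a monotone one. -/
theorem relPow_of_strip {R : Γ → Γ → Prop}
    (hR : ∀ n x y z w, RelPow R n x y → RelPow R n z y → RelPow R n z w → RelPow R n x w)
    (N : ℕ) : ∀ (x : ℤ → Γ) (l : ℤ → ℤ) (i j : ℤ), j = i + N →
      (∀ t, i ≤ t → t < j → (l (t + 1) = l t + 1 ∧ R (x t) (x (t + 1))) ∨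
        (l (t + 1) = l t - 1 ∧ R (x (t + 1)) (x t))) →
      (∀ t, i ≤ t → t ≤ j → l i ≤ l t ∧ l t ≤ l j) →
      ∀ h : ℕ, l j = l i + h → RelPow R h (x i) (x j) := by
  induction N using Nat.strong_induction_on with
  | _ N ih =>
  intro x l i j hij hstep hbd h hh
  -- `T` is the first time at the top level, `s` the last time at the bottom level.
  obtain ⟨T, ⟨hiT, hTj, hT⟩, hTmin⟩ := Int.exists_least_of_bdd
    (P := fun t => i ≤ t ∧ t ≤ j ∧ l t = l j) ⟨i, fun z hz => hz.1⟩ ⟨j, by omega, le_rfl, rfl⟩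
  obtain ⟨s, ⟨his, hsj, hs⟩, hsmax⟩ := Int.exists_greatest_of_bdd
    (P := fun t => i ≤ t ∧ t ≤ j ∧ l t = l i) ⟨j, fun z hz => hz.2.1⟩ ⟨i, le_rfl, by omega, rfl⟩
  have sub : ∀ a b : ℤ, i ≤ a → a ≤ b → b ≤ j → b - a < N →
      (∀ t, a ≤ t → t ≤ b → l a ≤ l t ∧ l t ≤ l b) → ∀ h : ℕ, l b = l a + h →
      RelPow R h (x a) (x b) := by
    intro a b ha hab hb hlt hbd' h' hh'
    exact ih (b - a).toNat (by omega) x l a b (by omega)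
      (fun t h1 h2 => hstep t (by omega) (by omega)) hbd' h' hh'
  by_cases h0 : h = 0
  · subst h0
    have : j = i := by
      by_contra hne
      have h1 := hstep i le_rfl (by omega)
      have h2 := hbd (i + 1) (by omega) (by omega)
      push_cast at hh
      rcases h1 with h1 | h1 <;> omega
    subst this
    exact rfl
  have hsT : s ≠ T := by rintro rfl; omega
  rcases lt_or_gt_of_ne hsT with hlt | hlt
  · have hfirst : ∀ t, i ≤ t → t < T → l t < l j := fun t h1 h2 => by
      have h3 := hbd t h1 (by omega)
      by_contra h4
      have := hTmin t ⟨h1, by omega, by omega⟩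
      omega
    have hlast : ∀ t, s < t → t ≤ j → l i < l t := fun t h1 h2 => by
      have h3 := hbd t (by omega) h2
      by_contra h4
      have := hsmax t ⟨by omega, by omega, by omega⟩
      omega
    have hsstep := hstep s his (by omega)
    have hTstep := hstep (T - 1) (by omega) (by omega)
    rw [sub_add_cancel] at hTstep
    have hls := hlast (s + 1) (by omega) (by omega)
    have hlT := hfirst (T - 1) (by omega) (by omega)
    obtain ⟨g, rfl⟩ : ∃ g, h = g + 1 := ⟨h - 1, by omega⟩
    push_cast at hh
    have hs1 : l (s + 1) = l i + 1 ∧ R (x s) (x (s + 1)) := by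
      rcases hsstep with h1 | h1
      · exact ⟨by omega, h1.2⟩
      · omega
    have hT1 : l (T - 1) = l j - 1 ∧ R (x (T - 1)) (x T) := by
      rcases hTstep with h1 | h1
      · exact ⟨by omega, h1.2⟩
      · omega
    -- Without its last step to the top, resp. its first step from the bottom, each of the two walks
    -- has height `h - 1`. They overlap on the segment from `s + 1` to `T - 1`, of height `h - 2`,
    -- where difunctionality joins them.
    have w1 : RelPow R g (x i) (x (T - 1)) := by
      refine sub i (T - 1) le_rfl (by omega) (by omega) (by omega) (fun t h1 h2 => ?_) g (by omega)
      have h3 := hbd t h1 (by omega)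
      have h4 := hfirst t h1 (by omega)
      omega
    have w2 : RelPow R g (x (s + 1)) (x j) := by
      refine sub (s + 1) j (by omega) (by omega) le_rfl (by omega) (fun t h1 h2 => ?_) g (by omega)
      have h3 := hbd t (by omega) h2
      have h4 := hlast t (by omega) h2
      omega
    -- For height one there is no overlap: the single step from `s` to `T` joins the two ends.
    cases g with
    | zero =>
      have hsT' : s = T - 1 := by
        have := hTmin (s + 1) ⟨by omega, by omega, by omega⟩
        omega
      have e1 : x i = x (T - 1) := w1
      have e2 : x (s + 1) = x j := w2
      refine ⟨x j, ?_, rfl⟩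
      rw [e1, ← hsT', ← e2]
      exact hs1.2
    | succ g =>
      have hsT' : s + 1 ≤ T - 1 := by
        by_contra h1
        have : s + 1 = T := by omega
        rw [this] at hs1
        omega
      have w3 : RelPow R g (x (s + 1)) (x (T - 1)) := by
        refine sub (s + 1) (T - 1) (by omega) hsT' (by omega) (by omega) (fun t h1 h2 => ?_) g
          (by omega)
        have h3 := hfirst t (by omega) (by omega)
        have h4 := hlast t (by omega) (by omega)
        omega
      obtain ⟨a, ha, haT⟩ := w1
      obtain ⟨b, hb, hbj⟩ := w2.unsnoc
      exact ⟨a, ha, (hR g a _ _ b haT w3 hb).snoc hbj⟩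
  -- Here the walk climbs to `T`, descends to `s` and climbs again. All three segments have full
  -- height `h`, the middle one after reversal, and difunctionality composes them.
  · have hiT' : i ≠ T := by rintro rfl; omega
    have hsj' : s ≠ j := by rintro rfl; omega
    have w1 : RelPow R h (x i) (x T) := by
      refine sub i T le_rfl hiT hTj (by omega) (fun t h1 h2 => ?_) h (by omega)
      have h3 := hbd t h1 (by omega)
      omega
    have w2 : RelPow R h (x s) (x j) := by
      refine sub s j his hsj le_rfl (by omega) (fun t h1 h2 => ?_) h (by omega)
      have h3 := hbd t (by omega) h2
      omega
    have w3 : RelPow R h (x s) (x T) := by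
      have := ih (s - T).toNat (by omega) (fun t => x (-t)) (fun t => l (-t)) (-s) (-T) (by omega)
        (fun t h1 h2 => ?_) (fun t h1 h2 => ?_) h (by simp only [neg_neg]; omega)
      · simpa only [neg_neg] using this
      · have h3 := hstep (-t - 1) (by omega) (by omega)
        rw [sub_add_cancel] at h3
        have h4 : -(t + 1) = -t - 1 := by ring
        rw [h4]
        rcases h3 with h3 | h3
        · exact .inr ⟨by omega, h3.2⟩
        · exact .inl ⟨by omega, h3.2⟩
      · simp only [neg_neg]
        have h3 := hbd (-t) (by omega) (by omega)
        omega
    exact hR h _ _ _ _ w1 w3 w2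

end Strips

/-! ### Lines and arms of keys -/

section KeyRelations

variable {σ : Signature} {V α G : Type*}

/-- The atom at the start of a step in the given direction. -/
def Query.src (q : Query σ V) (dir : Bool) : Term σ V := bif dir then q.A else q.B

/-- The atom at the end of a step in the given direction. -/
def Query.tgt (q : Query σ V) (dir : Bool) : Term σ V := bif dir then q.B else q.A

/-- Two key tuples are related if they are the keys of a solution; with `dir = false` the second
key tuple belongs to the first fact of the solution. -/
def Query.KeyStep (q : Query σ V) (dir : Bool) (k k' : Fin σ.keyLen → α) : Prop :=
  ∃ μ : V → α, μ ∘ keyTuple (q.src dir) = k ∧ μ ∘ keyTuple (q.tgt dir) = k'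

theorem Query.keyStep_false {q : Query σ V} {k k' : Fin σ.keyLen → α} :
    q.KeyStep false k k' ↔ q.KeyStep true k' k := exists_congr fun _ => and_comm

theorem Query.Sol.keyStep {q : Query σ V} {a b : Term σ α} (h : q.Sol a b) :
    q.KeyStep true (keyTuple a) (keyTuple b) := by
  obtain ⟨μ, rfl, rfl⟩ := h
  exact ⟨μ, rfl, rfl⟩

theorem Query.KeyStep.map {q : Query σ V} {β : Type*} {dir : Bool} {k k' : Fin σ.keyLen → α}
    (h : q.KeyStep dir k k') (f : α → β) : q.KeyStep dir (f ∘ k) (f ∘ k') := by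
  obtain ⟨μ, rfl, rfl⟩ := h
  exact ⟨f ∘ μ, rfl, rfl⟩

/-- The key at the end of a step can be read off the fact at its start; this later separates the two
facts of a block. -/
theorem Query.TwoWayDetermined.tgt_mem {q : Query σ V} (hq : q.TwoWayDetermined) (dir : Bool)
    (i : Fin σ.keyLen) : ∃ j, q.src dir j = keyTuple (q.tgt dir) i := by
  cases dir
  · exact hq.2.2.1 ⟨i, rfl⟩
  · exact hq.2.2.2 ⟨i, rfl⟩

/-- A bi-infinite chain of solutions, on keys. -/
def Query.IsLine (q : Query σ V) (k : ℤ → Fin σ.keyLen → α) : Prop :=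
  ∀ i, q.KeyStep true (k i) (k (i + 1))

/-- A chain of solutions with directions `dir`, on keys. -/
def Query.IsArm (q : Query σ V) (dir : ℕ → Bool) (x : ℕ → Fin σ.keyLen → α) : Prop :=
  ∀ t, q.KeyStep (dir t) (x t) (x (t + 1))

/-- The number of forward steps minus the number of backward steps. -/
def level (dir : ℕ → Bool) : ℕ → ℤ
  | 0 => 0
  | t + 1 => level dir t + bif dir t then 1 else -1

theorem abs_level_le (dir : ℕ → Bool) (t : ℕ) : |level dir t| ≤ t := by
  induction t with
  | zero => simp [level]
  | succ t ih =>
    rw [level, abs_le] at *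
    cases dir t <;> simp only [cond_true, cond_false] <;> push_cast <;> omega

theorem level_of_eventually {dir : ℕ → Bool} {N : ℕ} (h : ∀ t, N ≤ t → dir t = true) {t : ℕ}
    (ht : N ≤ t) : level dir t = level dir N + (t - N) := by
  induction t, ht using Nat.le_induction with
  | base => simp
  | succ t ht ih => rw [level, ih, h t ht, cond_true]; push_cast; ring

theorem Query.IsLine.keyStep {q : Query σ V} {k : ℤ → Fin σ.keyLen → α} (hk : q.IsLine k)
    (dir : Bool) (i : ℤ) : q.KeyStep dir (k i) (k (i + bif dir then 1 else -1)) := by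
  cases dir
  · rw [Query.keyStep_false]
    simpa using hk (i + -1)
  · exact hk i

/-- A backward step just moves one place back on the line, so one line serves every sequence of
directions. -/
theorem Query.IsLine.isArm {q : Query σ V} {k : ℤ → Fin σ.keyLen → α} (hk : q.IsLine k)
    (dir : ℕ → Bool) (L : ℤ) : q.IsArm dir fun t => k (L + level dir t) := by
  intro t
  have := hk.keyStep (dir t) (L + level dir t)
  rwa [add_assoc] at this

theorem Query.IsLine.shift {q : Query σ V} {k : ℤ → Fin σ.keyLen → α} (hk : q.IsLine k)
    (c : ℤ) : q.IsLine fun i => k (i + c) := by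
  intro i
  have := hk (i + c)
  rwa [add_right_comm] at this

/-- Two key tuples are connected by a chain of solutions. -/
def Query.KeyReach (q : Query σ V) : (Fin σ.keyLen → α) → (Fin σ.keyLen → α) → Prop :=
  Relation.ReflTransGen fun k k' => q.KeyStep true k k' ∨ q.KeyStep true k' k

/-- The connecting chain is put in front of the line, which is then followed forward forever, with
shift `c`. -/
theorem Query.KeyReach.exists_arm {q : Query σ V} {δ : ℤ → Fin σ.keyLen → α} (hδ : q.IsLine δ)
    {k : Fin σ.keyLen → α} (h : q.KeyReach k (δ 0)) :
    ∃ (dir : ℕ → Bool) (x : ℕ → Fin σ.keyLen → α) (N : ℕ) (c : ℤ), q.IsArm dir x ∧ x 0 = k ∧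
      ∀ t, N ≤ t → dir t = true ∧ x t = δ (t + c) := by
  induction h using Relation.ReflTransGen.head_induction_on with
  | refl =>
    exact ⟨fun _ => true, fun t => δ t, 0, 0, fun t => by simpa using hδ t, rfl,
      fun t _ => by simp⟩
  | head hab _ ih =>
    rename_i a b _
    obtain ⟨dir, x, N, c, harm, rfl, hN⟩ := ih
    obtain ⟨e, he⟩ : ∃ e, q.KeyStep e a (x 0) := by
      rcases hab with hab | hab
      · exact ⟨true, hab⟩
      · exact ⟨false, Query.keyStep_false.2 hab⟩
    refine ⟨fun t => Nat.casesOn t e dir, fun t => Nat.casesOn t a x, N + 1, c - 1, ?_, rfl, ?_⟩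
    · rintro (_ | t)
      · exact he
      · exact harm t
    · rintro (_ | t) ht
      · omega
      · obtain ⟨h1, h2⟩ := hN t (by omega)
        refine ⟨h1, h2.trans ?_⟩
        congr 1
        push_cast
        ring

/-! ### Group-valued labellings -/

variable [AddCommGroup G]

theorem Query.KeyStep.zero (q : Query σ V) (dir : Bool) :
    q.KeyStep dir (0 : Fin σ.keyLen → G) 0 := ⟨0, rfl, rfl⟩

theorem Query.KeyStep.sub {q : Query σ V} {dir : Bool} {k k' l l' : Fin σ.keyLen → G}
    (h : q.KeyStep dir k k') (h' : q.KeyStep dir l l') : q.KeyStep dir (k - l) (k' - l') := by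
  obtain ⟨μ, rfl, rfl⟩ := h
  obtain ⟨ν, rfl, rfl⟩ := h'
  exact ⟨μ - ν, rfl, rfl⟩

theorem RelPow.sub {q : Query σ V} {n : ℕ} {k k' l l' : Fin σ.keyLen → G}
    (h : RelPow (q.KeyStep true) n k k') (h' : RelPow (q.KeyStep true) n l l') :
    RelPow (q.KeyStep true) n (k - l) (k' - l') := by
  induction n generalizing k l with
  | zero => exact congrArg₂ (· - ·) h h'
  | succ n ih =>
    obtain ⟨a, ha, ha'⟩ := h
    obtain ⟨b, hb, hb'⟩ := h'
    exact ⟨a - b, ha.sub hb, ih ha' hb'⟩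

/-- Powers are closed under subtraction, and `x - (z - z) = x`, `y - (y - w) = w`. -/
theorem RelPow.keyStep_difunctional {q : Query σ V} (n : ℕ) (x y z w : Fin σ.keyLen → G)
    (h₁ : RelPow (q.KeyStep true) n x y) (h₂ : RelPow (q.KeyStep true) n z y)
    (h₃ : RelPow (q.KeyStep true) n z w) : RelPow (q.KeyStep true) n x w := by
  simpa using h₁.sub (h₂.sub h₃)

/-- If the zero tuple is connected to a line, then some line interpolates between both. -/
theorem Query.IsLine.exists_line_of_zero {q : Query σ V} {δ : ℤ → Fin σ.keyLen → G}
    (hδ : q.IsLine δ) (h : q.KeyReach 0 (δ 0)) :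
    ∃ (k : ℤ → Fin σ.keyLen → G) (c h : ℤ), q.IsLine k ∧ (∀ i ≤ 0, k i = 0) ∧
      ∀ i, h ≤ i → k i = δ (i + c) := by
  obtain ⟨dir, x, N, c, harm, hx0, hN⟩ := h.exists_arm hδ
  -- The arm is prolonged to negative times by forward steps from zero to zero.
  set y : ℤ → Fin σ.keyLen → G := fun t => x t.toNat with hy
  set l : ℤ → ℤ := fun t => if t ≤ 0 then t else level dir t.toNat with hl
  have hlev : ∀ t : ℕ, l t = level dir t := by
    intro t
    simp only [hl]
    split_ifs with h0
    · obtain rfl : t = 0 := by omega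
      rfl
    · simp
  have hlneg : ∀ t : ℤ, t ≤ 0 → l t = t := fun t ht => if_pos ht
  have hbd : ∀ t : ℕ, -(t : ℤ) ≤ l t ∧ l t ≤ t := fun t => by
    rw [hlev]
    exact abs_le.1 (abs_level_le dir t)
  have hlate : ∀ t : ℕ, N ≤ t → l t = l N + (t - N) := fun t ht => by
    rw [hlev, hlev]
    exact level_of_eventually (fun t ht => (hN t ht).1) ht
  have hNb := hbd N
  have h3N := hlate (3 * N) (by omega)
  push_cast at h3N
  obtain ⟨H, hH⟩ : ∃ H : ℕ, l (3 * N) = l (-N) + H := by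
    refine ⟨(l (3 * N) - l (-N)).toNat, ?_⟩
    rw [hlneg (-N) (by omega)]
    omega
  -- Up to time `N` all levels are at most `N`, and none is below `-N`, the level at time `-N`. The
  -- `2 * N` forward steps after time `N` raise the final level to at least `N`, so the walk stays
  -- in the strip.
  have hpow := relPow_of_strip (R := q.KeyStep true) RelPow.keyStep_difunctional (4 * N) y l
    (-N) (3 * N) (by push_cast; ring) (fun t h1 h2 => ?_) (fun t h1 h2 => ?_) H hH
  · have e1 : y (-N) = 0 := by simp [hy, hx0]
    have e2 : y (3 * N) = δ (3 * N + c) := by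
      have : ((3 : ℤ) * N).toNat = 3 * N := by omega
      simp only [hy, this]
      rw [(hN (3 * N) (by omega)).2]
      push_cast
      rfl
    rw [e1, e2] at hpow
    obtain ⟨κ, hκ0, hκH, hκ⟩ := hpow.exists_seq
    refine ⟨fun i => if i ≤ 0 then 0 else if i < H then κ i.toNat else δ (i + (3 * N + c - H)),
      3 * N + c - H, H + 1, ?_, fun i hi => if_pos hi, fun i hi => ?_⟩
    · intro i
      rcases lt_or_ge i 0 with hi | hi
      · simp only [if_pos hi.le, if_pos (show i + 1 ≤ 0 by omega)]
        exact .zero q true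
      · lift i to ℕ using hi
        have hcur : (if (i : ℤ) ≤ 0 then (0 : Fin σ.keyLen → G) else
            if (i : ℤ) < H then κ (i : ℤ).toNat else δ (i + (3 * N + c - H))) =
            if i < H then κ i else δ (i + (3 * N + c - H)) := by
          by_cases h0 : i = 0
          · subst h0
            simp only [Nat.cast_zero, le_refl, if_true]
            split_ifs with h1
            · exact hκ0.symm
            · obtain rfl : H = 0 := by omega
              rw [hκ0] at hκH
              simpa using hκH
          · rw [if_neg (by omega)]
            simp
        have hnext : (if (i : ℤ) + 1 ≤ 0 then (0 : Fin σ.keyLen → G) else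
            if (i : ℤ) + 1 < H then κ ((i : ℤ) + 1).toNat else
              δ ((i : ℤ) + 1 + (3 * N + c - H))) =
            if i + 1 < H then κ (i + 1) else δ (i + (3 * N + c - H) + 1) := by
          rw [if_neg (by omega)]
          have e : ((i : ℤ) + 1).toNat = i + 1 := by omega
          have e' : ((i : ℤ) + 1 < H) ↔ i + 1 < H := by omega
          rw [e]
          simp only [e']
          congr 2
          ring
        beta_reduce
        rw [hcur, hnext]
        rcases lt_trichotomy (i + 1) H with h1 | h1 | h1
        · rw [if_pos h1, if_pos (by omega)]
          exact hκ i (by omega)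
        · rw [if_pos (show i < H by omega), if_neg (show ¬ i + 1 < H by omega)]
          have := hκ i (by omega)
          rw [h1, hκH] at this
          convert this using 2
          rw [← h1]
          push_cast
          ring
        · rw [if_neg (by omega), if_neg (by omega)]
          exact hδ _
    · beta_reduce
      by_cases h0 : i ≤ 0
      · omega
      · rw [if_neg h0, if_neg (by omega)]
  · rcases lt_or_ge t 0 with ht | ht
    · left
      rw [hlneg t ht.le, hlneg (t + 1) (by omega)]
      have e1 : t.toNat = 0 := by omega
      have e2 : (t + 1).toNat = 0 := by omega
      refine ⟨rfl, ?_⟩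
      simp only [hy, e1, e2, hx0]
      exact .zero q true
    · lift t to ℕ using ht
      have hs := harm t
      have e2 : ((t : ℤ) + 1) = ((t + 1 : ℕ) : ℤ) := by push_cast; rfl
      rw [e2, hlev, hlev, level]
      simp only [hy, Int.toNat_natCast]
      cases hd : dir t
      · rw [hd, Query.keyStep_false] at hs
        exact .inr ⟨by simp only [cond_false]; ring, hs⟩
      · rw [hd] at hs
        exact .inl ⟨by simp only [cond_true], hs⟩
  · rw [hlneg (-N) (by omega)]
    rcases lt_or_ge t 0 with ht | ht
    · rw [hlneg t ht.le]
      omega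
    · lift t to ℕ using ht
      have := hbd t
      rcases le_total t N with htN | htN
      · omega
      · have := hlate t htN
        omega

/-- A line that starts as `δ` and ends as zero. -/
theorem Query.IsLine.exists_line_to_zero {q : Query σ V} {δ : ℤ → Fin σ.keyLen → G}
    (hδ : q.IsLine δ) (h : q.KeyReach 0 (δ 0)) :
    ∃ (k : ℤ → Fin σ.keyLen → G) (c h : ℤ), q.IsLine k ∧ (∀ i ≤ c, k i = δ i) ∧
      ∀ i, h ≤ i → k i = 0 := by
  obtain ⟨k, c, h, hk, hk0, hkδ⟩ := hδ.exists_line_of_zero h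
  -- Subtracting the aligned line from zero to `δ` leaves `δ` on the left and zero on the right.
  refine ⟨fun i => δ i - k (i + -c), c, h + c, fun i => (hδ i).sub (hk.shift (-c) i),
    fun i hi => ?_, fun i hi => ?_⟩
  · beta_reduce
    rw [hk0 _ (by omega), sub_zero]
  · beta_reduce
    rw [hkδ _ (by omega), neg_add_cancel_right, sub_self]

/-- Shift an interpolating line so that its first nonzero entry sits at `1`, or, for a backward
step, its last one at `-1`. Periodicity of `δ` ensures that there is such an entry. -/
theorem Query.IsLine.exists_fresh_line {q : Query σ V} {δ : ℤ → Fin σ.keyLen → G}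
    (hδ : q.IsLine δ) (hper : ∀ i, δ (i + 3) = δ i) (h0 : δ 0 ≠ 0) (h : q.KeyReach 0 (δ 0))
    (dir : Bool) :
    ∃ k : ℤ → Fin σ.keyLen → G, q.IsLine k ∧
      (∀ i : ℤ, (bif dir then i else -i) ≤ 0 → k i = 0) ∧ k (bif dir then 1 else -1) ≠ 0 := by
  have hper' : ∀ n : ℤ, δ (3 * n) ≠ 0 := by
    intro n
    have : Function.Periodic δ 3 := hper
    have := this.int_mul n 0
    rw [zero_add, Int.cast_id, mul_comm] at this
    rwa [this]
  cases dir
  · obtain ⟨k, c, h, hk, hkδ, hk0⟩ := hδ.exists_line_to_zero h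
    obtain ⟨m, hm, hmax⟩ := Int.exists_greatest_of_bdd (P := fun i => k i ≠ 0)
      ⟨h, fun z hz => by by_contra hz'; exact hz (hk0 z (by omega))⟩
      ⟨3 * (-|c|), by
        rw [hkδ _ (by have := neg_abs_le c; have := abs_nonneg c; omega)]; exact hper' _⟩
    refine ⟨fun i => k (i + (m + 1)), hk.shift _, fun i hi => ?_, ?_⟩
    · simp only [cond_false] at hi
      by_contra hne
      have := hmax _ hne
      omega
    · simpa using hm
  · obtain ⟨k, c, h, hk, hk0, hkδ⟩ := hδ.exists_line_of_zero h
    obtain ⟨m, hm, hmin⟩ := Int.exists_least_of_bdd (P := fun i => k i ≠ 0)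
      ⟨0, fun z hz => by by_contra hz'; exact hz (hk0 z (by omega))⟩
      -- Beyond `h`, and a multiple of 3 after the shift by `c`.
      ⟨3 * (|h| + |c|) - c, by
        rw [hkδ _ (by
          have := le_abs_self h; have := le_abs_self c; have := abs_nonneg c
          have := abs_nonneg h; omega), sub_add_cancel]
        exact hper' _⟩
    refine ⟨fun i => k (i + (m - 1)), hk.shift _, fun i hi => ?_, ?_⟩
    · simp only [cond_true] at hi
      by_contra hne
      have := hmin _ hne
      omega
    · simpa using hm

/-- Along every arm there is a labelling that becomes nonzero exactly after step `j`. -/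
theorem Query.IsLine.exists_fresh_arm {q : Query σ V} {δ : ℤ → Fin σ.keyLen → G}
    (hδ : q.IsLine δ) (hper : ∀ i, δ (i + 3) = δ i) (h0 : δ 0 ≠ 0) (h : q.KeyReach 0 (δ 0))
    (dir : ℕ → Bool) (j : ℕ) :
    ∃ x : ℕ → Fin σ.keyLen → G, q.IsArm dir x ∧ (∀ t ≤ j, x t = 0) ∧ x (j + 1) ≠ 0 := by
  obtain ⟨k, hk, hk0, hk1⟩ := hδ.exists_fresh_line hper h0 h (dir j)
  have hkz : k 0 = 0 := hk0 0 (by cases dir j <;> simp)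
  -- At time `j` the line is read at position `0`, where it vanishes, so the earlier labels may be
  -- replaced by zero.
  refine ⟨fun t => if t ≤ j then 0 else k (-level dir j + level dir t), fun t => ?_,
    fun t ht => if_pos ht, ?_⟩
  · rcases lt_or_ge t j with ht | ht
    · simp only [if_pos ht.le, if_pos (show t + 1 ≤ j by omega)]
      exact .zero q _
    · have hs := hk.isArm dir (-level dir j) t
      beta_reduce at hs ⊢
      rw [if_neg (show ¬ t + 1 ≤ j by omega)]
      split_ifs with h1
      · obtain rfl : t = j := by omega
        rwa [neg_add_cancel, hkz] at hs
      · exact hs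
  · beta_reduce
    rw [if_neg (by omega), level, neg_add_cancel_left]
    exact hk1

end KeyRelations

/-! ### Presenting tripaths by nodes and by three arms -/

section Presentations

variable {σ : Signature} {V α : Type*}

/-- A tripath given by its tree of nodes, each with its facts `a` and `b`. -/
structure TripathData (q : Query σ V) (α N : Type*) where
  a : N → Term σ α
  b : N → Term σ α
  keyEq : ∀ n, KeyEq (a n) (b n)
  eq_of_keyEq : ∀ n m, KeyEq (b n) (b m) → n = m
  parent : N → Option N
  root : N
  parent_eq_none_iff : ∀ n, parent n = none ↔ n = root
  reaches_root : ∀ n, Relation.ReflTransGen (fun m₁ m₂ => parent m₁ = some m₂) n root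
  leaf₁ : N
  leaf₂ : N
  leaf_ne : leaf₁ ≠ leaf₂
  leaf_iff : ∀ n, (∀ m, parent m ≠ some n) ↔ (n = leaf₁ ∨ n = leaf₂)
  root_eq : b root = a root
  leaf₁_eq : a leaf₁ = b leaf₁
  leaf₂_eq : a leaf₂ = b leaf₂
  inner_ne : ∀ n, n ≠ root → n ≠ leaf₁ → n ≠ leaf₂ → a n ≠ b n
  edge : ∀ n m, parent m = some n → q.SymSol (a n) (b m)
  branch : N
  childD : N
  childF : N
  child_ne : childD ≠ childF
  parent_childD : parent childD = some branch
  parent_childF : parent childF = some branch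
  sol_de : q.Sol (b childD) (a branch)
  sol_ef : q.Sol (a branch) (b childF)
  not_subset_root : ¬ gSet (b childD) (a branch) (b childF) ⊆ keySet (a root)
  not_subset_leaf₁ : ¬ gSet (b childD) (a branch) (b childF) ⊆ keySet (b leaf₁)
  not_subset_leaf₂ : ¬ gSet (b childD) (a branch) (b childF) ⊆ keySet (b leaf₂)

/-- Since `g(e)` is always the key of `d`, `e` or `f`, its case distinction can be avoided in the
construction. -/
theorem not_gSet_subset {d e f : Term σ α} {s : Set α} (hd : ¬ keySet d ⊆ s)
    (he : ¬ keySet e ⊆ s) (hf : ¬ keySet f ⊆ s) : ¬ gSet d e f ⊆ s := by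
  unfold gSet gTuple
  split_ifs <;> assumption

/-- Three arms of length `n` that start in the facts of a fork center (`c 0 0`, `c 1 0`, `c 2 0`).
The node `t` of the arm `s` has the fact `c s t` towards the center and the fact `o s t` away from
it. -/
structure ForkArms (q : Query σ V) (α : Type*) (n : ℕ) where
  c : Fin 3 → ℕ → Term σ α
  o : Fin 3 → ℕ → Term σ α
  sol_de : q.Sol (c 0 0) (c 1 0)
  sol_ef : q.Sol (c 1 0) (c 2 0)
  not_sol_fd : ¬ q.Sol (c 2 0) (c 0 0)
  keyEq : ∀ s, ∀ t < n, KeyEq (c s t) (o s t)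
  ne : ∀ s, ∀ t < n, c s t ≠ o s t
  symSol : ∀ s, ∀ t < n, q.SymSol (o s t) (c s (t + 1))
  eq_of_keyEq : ∀ s, ∀ t ≤ n, ∀ s', ∀ t' ≤ n, KeyEq (c s t) (c s' t') → s = s' ∧ t = t'
  not_subset : ∀ s s', ¬ keySet (c s' 0) ⊆ keySet (c s n)

theorem ForkArms.map {n : ℕ} {q : Query σ V} (F : ForkArms q α n) {β : Type*} (f : α → β)
    (hf : Function.Injective f) : Nonempty (ForkArms q β n) := by
  have hkey : ∀ a b : Term σ α, KeyEq (fun i => f (a i)) (fun i => f (b i)) ↔ KeyEq a b :=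
    fun a b => ⟨fun h => funext fun i => hf (congrFun h i), fun h => congrArg (f ∘ ·) h⟩
  have hset : ∀ a : Term σ α, keySet (fun i => f (a i)) = f '' keySet a := fun a =>
    Set.range_comp f (keyTuple a)
  have : Nonempty α := ⟨F.c 0 0 ⟨0, σ.arity_pos⟩⟩
  exact ⟨{
    c := fun s t i => f (F.c s t i)
    o := fun s t i => f (F.o s t i)
    sol_de := F.sol_de.map f
    sol_ef := F.sol_ef.map f
    -- A left inverse of `f` pulls the forbidden solution back.
    not_sol_fd := fun h => F.not_sol_fd (by
      simpa [Function.leftInverse_invFun hf _] using h.map (Function.invFun f))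
    keyEq := fun s t ht => (hkey _ _).2 (F.keyEq s t ht)
    ne := fun s t ht h => F.ne s t ht (funext fun i => hf (congrFun h i))
    symSol := fun s t ht => (F.symSol s t ht).imp (fun h => h.map f) fun h => h.map f
    eq_of_keyEq := fun s t ht s' t' ht' h => F.eq_of_keyEq s t ht s' t' ht' ((hkey _ _).1 h)
    not_subset := fun s s' h => F.not_subset s s' (by
      rwa [hset, hset, Set.image_subset_image_iff hf] at h) }⟩

variable [DecidableEq α] {q : Query σ V} {N : Type*} [Fintype N]

namespace TripathData

variable (T : TripathData q α N)

/-- The underlying database of a presented tripath. -/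
def facts : Finset (Term σ α) := Finset.univ.biUnion fun n => {T.a n, T.b n}

theorem mem_facts {x : Term σ α} : x ∈ T.facts ↔ ∃ n, x = T.a n ∨ x = T.b n := by
  simp [facts]

/-- The block of a node. -/
def block (n : N) : Block T.facts := blockOf T.facts (T.b n) (T.mem_facts.2 ⟨n, .inr rfl⟩)

theorem block_val (n : N) : (T.block n).1 = {T.a n, T.b n} := by
  ext x
  rw [block, mem_blockOf, T.mem_facts, Finset.mem_insert, Finset.mem_singleton]
  constructor
  · rintro ⟨⟨m, rfl | rfl⟩, h⟩
    · obtain rfl := T.eq_of_keyEq n m (h.trans (T.keyEq m))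
      exact .inl rfl
    · obtain rfl := T.eq_of_keyEq n m h
      exact .inr rfl
  · rintro (rfl | rfl)
    · exact ⟨⟨n, .inl rfl⟩, (T.keyEq n).symm⟩
    · exact ⟨⟨n, .inr rfl⟩, rfl⟩

theorem block_bijective : Function.Bijective T.block := by
  constructor
  · intro n m h
    exact T.eq_of_keyEq n m ((blockOf_eq_iff _ _).1 h)
  · intro B
    obtain ⟨x, hx, rfl⟩ := exists_eq_blockOf B
    obtain ⟨n, rfl | rfl⟩ := T.mem_facts.1 hx
    · exact ⟨n, (blockOf_eq_iff _ _).2 (T.keyEq n).symm⟩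
    · exact ⟨n, rfl⟩

/-- The nodes are the blocks. -/
noncomputable def equiv : N ≃ Block T.facts := Equiv.ofBijective T.block T.block_bijective

theorem equiv_val (n : N) : (T.equiv n).1 = {T.a n, T.b n} := T.block_val n

/-- The tripath that is presented. -/
noncomputable def toTripath : Tripath q T.facts where
  parent B := (T.parent (T.equiv.symm B)).map T.equiv
  root := T.equiv T.root
  parent_eq_none_iff B := by
    rw [Option.map_eq_none_iff, T.parent_eq_none_iff, Equiv.symm_apply_eq]
  reaches_root B := by
    obtain ⟨n, rfl⟩ := T.equiv.surjective B
    exact (T.reaches_root n).lift T.equiv fun m m' h => by simp [Function.onFun, h]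
  leaf₁ := T.equiv T.leaf₁
  leaf₂ := T.equiv T.leaf₂
  leaf_ne := T.equiv.injective.ne T.leaf_ne
  leaf_iff B := by
    obtain ⟨n, rfl⟩ := T.equiv.surjective B
    rw [T.equiv.injective.eq_iff, T.equiv.injective.eq_iff, ← T.leaf_iff,
      T.equiv.surjective.forall]
    refine forall_congr' fun m => not_congr ?_
    simp
  a B := T.a (T.equiv.symm B)
  b B := T.b (T.equiv.symm B)
  root_facts := by rw [T.equiv_val]; simp [T.root_eq]
  leaf₁_facts := by rw [T.equiv_val]; simp [T.leaf₁_eq]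
  leaf₂_facts := by rw [T.equiv_val]; simp [T.leaf₂_eq]
  inner_facts B := by
    obtain ⟨n, rfl⟩ := T.equiv.surjective B
    simp only [T.equiv.injective.ne_iff, Equiv.symm_apply_apply]
    exact fun h0 h1 h2 => ⟨T.inner_ne n h0 h1 h2, T.equiv_val n⟩
  edge B B' := by
    obtain ⟨n, rfl⟩ := T.equiv.surjective B
    obtain ⟨m, rfl⟩ := T.equiv.surjective B'
    simp only [Equiv.symm_apply_apply]
    intro h
    refine T.edge n m ?_
    simpa using h
  branch := T.equiv T.branch
  childD := T.equiv T.childD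
  childF := T.equiv T.childF
  child_ne := T.equiv.injective.ne T.child_ne
  parent_childD := by simp [T.parent_childD]
  parent_childF := by simp [T.parent_childF]
  sol_de := by simpa using T.sol_de
  sol_ef := by simpa using T.sol_ef
  not_subset_root := by simpa using T.not_subset_root
  not_subset_leaf₁ := by simpa using T.not_subset_leaf₁
  not_subset_leaf₂ := by simpa using T.not_subset_leaf₂

theorem admitsForkTripath (h : ¬ q.Sol (T.b T.childF) (T.b T.childD)) :
    q.AdmitsForkTripath α := by
  refine ⟨T.facts, T.facts, subset_rfl, T.toTripath, ?_⟩
  unfold Tripath.IsFork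
  simpa [toTripath] using h

end TripathData

/-- The parent in the tree formed by three arms, of which the arm `1` leads to the root. -/
def armParent (n : ℕ) (x : Fin 3 × Fin (n + 1)) : Option (Fin 3 × Fin (n + 1)) :=
  if x.1 = 1 then if h : x.2.1 < n then some (1, ⟨x.2.1 + 1, by omega⟩) else none
  else if x.2.1 = 0 then some (1, 0) else some (x.1, ⟨x.2.1 - 1, by omega⟩)

/-- The tripath formed by three arms. -/
noncomputable def ForkArms.toTripathData {n : ℕ} (F : ForkArms q α n) :
    TripathData q α (Fin 3 × Fin (n + 1)) where
  -- `a` faces the children, which lie towards the center on the arm `1` and away from it on the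
  -- others. The end nodes keep only their `c`.
  a x := if x.1 = 1 ∨ x.2.1 = n then F.c x.1 x.2 else F.o x.1 x.2
  b x := if x.1 = 1 ∧ x.2.1 ≠ n then F.o x.1 x.2 else F.c x.1 x.2
  keyEq := by
    rintro ⟨s, t, ht⟩
    have := fun h => F.keyEq s t h
    dsimp only
    split_ifs with h1 h2 h2
    · exact this (by omega)
    · rfl
    · exact rfl
    · exact (this (by omega)).symm
  eq_of_keyEq := by
    have hb : ∀ x : Fin 3 × Fin (n + 1), KeyEq (F.c x.1 x.2)
        (if x.1 = 1 ∧ x.2.1 ≠ n then F.o x.1 x.2 else F.c x.1 x.2) := by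
      intro x
      split_ifs with h
      · exact F.keyEq _ _ (by omega)
      · rfl
    intro x y h
    obtain ⟨h1, h2⟩ := F.eq_of_keyEq _ _ (by omega) _ _ (by omega)
      (((hb x).trans h).trans (hb y).symm)
    exact Prod.ext h1 (Fin.ext h2)
  parent := armParent n
  root := (1, Fin.last n)
  parent_eq_none_iff := by
    rintro ⟨s, t, ht⟩
    unfold armParent
    simp only [Prod.mk.injEq, Fin.ext_iff, Fin.val_last]
    split_ifs <;> simp <;> omega
  reaches_root := by
    have h1 : ∀ t (ht : t < n + 1), Relation.ReflTransGen
        (fun m₁ m₂ => armParent n m₁ = some m₂) (1, ⟨t, ht⟩) (1, Fin.last n) := by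
      intro t ht
      induction h : n - t generalizing t with
      | zero =>
        obtain rfl : t = n := by omega
        exact .refl
      | succ k ih =>
        exact .head (by simp [armParent, show t < n by omega]) (ih (t + 1) (by omega) (by omega))
    rintro ⟨s, t, ht⟩
    by_cases hs : s = 1
    · subst hs
      exact h1 t ht
    · induction t with
      | zero => exact .head (by simp [armParent, hs]) (h1 0 (by omega))
      | succ t ih => exact .head (by simp [armParent, hs]) (ih (by omega))
  leaf₁ := (0, Fin.last n)
  leaf₂ := (2, Fin.last n)
  leaf_ne := by simp
  leaf_iff := by
    rintro ⟨s, t, ht⟩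
    constructor
    · intro h
      by_cases hs : s = 1
      · subst hs
        cases t with
        | zero => exact absurd (by simp [armParent]) (h (0, 0))
        | succ t => exact absurd (by simp [armParent]; omega) (h (1, ⟨t, by omega⟩))
      · by_cases htn : t = n
        · subst htn
          fin_cases s
          · exact .inl rfl
          · exact absurd rfl hs
          · exact .inr rfl
        · exact absurd (by simp [armParent, hs]) (h (s, ⟨t + 1, by omega⟩))
    · rintro h ⟨s', t', ht'⟩ hp
      unfold armParent at hp
      simp only [Prod.mk.injEq, Fin.ext_iff, Fin.val_last] at h
      dsimp only at hp
      split_ifs at hp with h1 h2 h2 <;>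
        simp only [Option.some.injEq, Prod.mk.injEq, Fin.ext_iff] at hp <;>
        simp at hp h <;> omega
  root_eq := by simp
  leaf₁_eq := by simp
  leaf₂_eq := by simp
  inner_ne := by
    rintro ⟨s, t, ht⟩ h0 h1 h2
    have hne : t ≠ n := by
      rintro rfl
      fin_cases s
      · exact h1 rfl
      · exact h0 rfl
      · exact h2 rfl
    have := F.ne s t (by omega)
    by_cases hs : s = 1
    · simpa [hs, hne] using hs ▸ this
    · simpa [hs, hne] using this.symm
  edge := by
    rintro ⟨s, t, ht⟩ ⟨s', t', ht'⟩ hp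
    unfold armParent at hp
    dsimp only at hp
    split_ifs at hp with h1 h2 h2
    · simp only [Option.some.injEq, Prod.mk.injEq, Fin.ext_iff] at hp
      obtain ⟨hs, rfl⟩ := hp
      obtain rfl : s = 1 := Fin.ext hs.symm
      subst h1
      have := (F.symSol 1 t' h2).symm
      simpa [show t' ≠ n by omega] using this
    · simp only [Option.some.injEq, Prod.mk.injEq] at hp
      obtain ⟨rfl, h3⟩ := hp
      obtain rfl : t = 0 := (Fin.ext_iff.1 h3).symm
      subst h2
      have h4 : s' = 0 ∨ s' = 2 := by omega
      rcases h4 with rfl | rfl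
      · simpa using (show q.SymSol (F.c 1 0) (F.c 0 0) from .inr F.sol_de)
      · simpa using (show q.SymSol (F.c 1 0) (F.c 2 0) from .inl F.sol_ef)
    · simp only [Option.some.injEq, Prod.mk.injEq, Fin.ext_iff] at hp
      obtain ⟨hs, rfl⟩ := hp
      obtain rfl : s' = s := Fin.ext hs
      have := F.symSol s' (t' - 1) (by omega)
      rw [Nat.sub_add_cancel (by omega)] at this
      simpa [h1, show t' - 1 ≠ n by omega] using this
  branch := (1, 0)
  childD := (0, 0)
  childF := (2, 0)
  child_ne := by simp
  parent_childD := by simp [armParent]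
  parent_childF := by simp [armParent]
  sol_de := by simpa using F.sol_de
  sol_ef := by simpa using F.sol_ef
  not_subset_root := by
    simpa using not_gSet_subset (F.not_subset 1 0) (F.not_subset 1 1) (F.not_subset 1 2)
  not_subset_leaf₁ := by
    simpa using not_gSet_subset (F.not_subset 0 0) (F.not_subset 0 1) (F.not_subset 0 2)
  not_subset_leaf₂ := by
    simpa using not_gSet_subset (F.not_subset 2 0) (F.not_subset 2 1) (F.not_subset 2 2)

theorem ForkArms.admitsForkTripath {n : ℕ} (F : ForkArms q α n) : q.AdmitsForkTripath α := by
  refine F.toTripathData.admitsForkTripath ?_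
  simpa [ForkArms.toTripathData] using F.not_sol_fd

end Presentations

/-! ### The fork-tripath over a product domain -/

section Construction

variable {σ : Signature} {V α G J : Type*} {q : Query σ V}

theorem Query.Sol.prod {a b : Term σ α} (h : q.Sol a b) {a' b' : Term σ α} (h' : q.Sol a' b')
    {g g' : J → Term σ G} (hg : ∀ c, q.Sol (g c) (g' c)) :
    q.Sol (fun i => (a i, a' i, fun c => g c i)) (fun i => (b i, b' i, fun c => g' c i)) := by
  obtain ⟨μ, rfl, rfl⟩ := h
  obtain ⟨ν, rfl, rfl⟩ := h'
  choose ρ h1 h2 using hg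
  refine ⟨fun v => (μ v, ν v, fun c => ρ c v), ?_, ?_⟩ <;> funext i
  · simp only [← h1]
  · simp only [← h2]

/-- If both keys vanish in a coordinate, the zero assignment is chosen there, so the coordinate
vanishes on the whole facts and not only on their keys. -/
theorem Query.KeyStep.prod [Zero G] {dir : Bool} {k k' : Fin σ.keyLen → α}
    (h : q.KeyStep dir k k') {l l' : Fin σ.keyLen → α} (h' : q.KeyStep dir l l')
    {y y' : J → Fin σ.keyLen → G} (hy : ∀ c, q.KeyStep dir (y c) (y' c)) :
    ∃ μ : V → α × α × (J → G),
      (∀ i, μ (keyTuple (q.src dir) i) = (k i, l i, fun c => y c i)) ∧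
      (∀ i, μ (keyTuple (q.tgt dir) i) = (k' i, l' i, fun c => y' c i)) ∧
      ∀ c, y c = 0 → y' c = 0 → ∀ v, (μ v).2.2 c = 0 := by
  obtain ⟨μ, rfl, rfl⟩ := h
  obtain ⟨ν, rfl, rfl⟩ := h'
  have hy' : ∀ c, ∃ ρ : V → G, ρ ∘ keyTuple (q.src dir) = y c ∧ ρ ∘ keyTuple (q.tgt dir) = y' c ∧
      (y c = 0 → y' c = 0 → ρ = 0) := by
    intro c
    by_cases h0 : y c = 0 ∧ y' c = 0
    · exact ⟨0, h0.1.symm, h0.2.symm, fun _ _ => rfl⟩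
    · obtain ⟨ρ, h1, h2⟩ := hy c
      exact ⟨ρ, h1, h2, fun h3 h4 => absurd ⟨h3, h4⟩ h0⟩
  choose ρ h1 h2 h3 using hy'
  refine ⟨fun v => (μ v, ν v, fun c => ρ c v), fun i => ?_, fun i => ?_, fun c h4 h5 v => ?_⟩
  · simp only [← h1, Function.comp]
  · simp only [← h2, Function.comp]
  · exact congrFun (h3 c h4 h5) v

theorem Query.KeyReach.map {β : Type*} {k k' : Fin σ.keyLen → α} (h : q.KeyReach k k')
    (f : α → β) : q.KeyReach (f ∘ k) (f ∘ k') := by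
  induction h with
  | refl => exact .refl
  | tail _ h ih => exact ih.tail (h.imp (fun h => h.map f) fun h => h.map f)

/-- A center that is not a triangle and that is connected to a triangle, from whose key an element
gets lost along some chain of solutions, can be extended to a fork-tripath over a larger domain. -/
theorem Query.TwoWayDetermined.exists_forkArms (hq : q.TwoWayDetermined) {u : ℤ → Term σ α}
    (hu : ∀ i, q.Sol (u i) (u (i + 1))) (hper : ∀ i, u (i + 3) = u i)
    (hne : ∀ s s' : Fin 3, KeyEq (u (s.1 - 1)) (u (s'.1 - 1)) → s = s')
    {ctr : Fin 3 → Term σ α} (hde : q.Sol (ctr 0) (ctr 1)) (hef : q.Sol (ctr 1) (ctr 2))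
    (hfd : ¬ q.Sol (ctr 2) (ctr 0)) (hctr : ∀ s, q.KeyReach (keyTuple (ctr s)) (keyTuple (u 0)))
    {y : Fin σ.keyLen → α} (hy : q.KeyReach y (keyTuple (u 0))) {p : α} (hp : p ∈ keySet (u 0))
    (hpy : p ∉ Set.range y) :
    ∃ n, Nonempty (ForkArms q (α × α × (Fin 3 ⊕ Fin 3 × Fin n → ZMod 2)) n) := by
  classical
  set χ : α → ZMod 2 := fun x => if x = p then 1 else 0 with hχ
  set δ : ℤ → Fin σ.keyLen → α := fun i => keyTuple (u i) with hδdef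
  have hδ : q.IsLine δ := fun i => (hu i).keyStep
  have hχδ : q.IsLine fun i => χ ∘ δ i := fun i => (hδ i).map χ
  have hχper : ∀ i, χ ∘ δ (i + 3) = χ ∘ δ i := fun i => by simp only [hδdef, hper]
  obtain ⟨ip, hip⟩ := hp
  have hχp : χ (δ 0 ip) = 1 := if_pos hip
  have hχ0 : χ ∘ δ 0 ≠ 0 := fun h => by
    have := congrFun h ip
    simp [hχp] at this
  have hreach : q.KeyReach 0 (χ ∘ δ 0) := by
    -- As `y` misses `p`, its indicator labelling is zero.
    have h0 : χ ∘ y = 0 := funext fun i => if_neg fun h => hpy ⟨i, h⟩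
    rw [← h0]
    exact hy.map χ
  have harms := fun s => (hctr s).exists_arm hδ
  choose dir x N c harm hx0 hN using harms
  obtain ⟨k, b, h, hk, hkδ, hk0⟩ := hχδ.exists_line_to_zero hreach
  have hfresh := fun s => hχδ.exists_fresh_arm hχper hχ0 hreach (dir s)
  choose fr hfr hfr0 hfr1 using hfresh
  -- All start positions `L X + s` are at most `b`, where `k` is still `χ ∘ δ`, and `L X + X` is a
  -- multiple of 3, where `p` is visible.
  set L : Fin 3 → ℤ := fun X => -3 * (|b| + 1) - X.1 with hL
  have hLb : ∀ X s : Fin 3, L X + s.1 ≤ b := fun X s => by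
    have := neg_abs_le b
    have := abs_nonneg b
    simp only [hL]
    omega
  -- The arms are long enough that every `k`-coordinate has died out at their ends; the level at `n`
  -- is at least `n - 2 * N s`.
  obtain ⟨n, hn⟩ : ∃ n : ℕ, ∀ X s : Fin 3, h ≤ L X + s.1 + level (dir s) n := by
    refine ⟨2 * (N 0 + N 1 + N 2) + (|h| + 3 * |b| + 10).toNat, fun X s => ?_⟩
    have hs : N s ≤ N 0 + N 1 + N 2 := by fin_cases s <;> simp <;> omega
    rw [level_of_eventually (fun t ht => (hN s t ht).1)
      (show N s ≤ 2 * (N 0 + N 1 + N 2) + (|h| + 3 * |b| + 10).toNat by omega)]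
    have h1 := (abs_le.1 (abs_level_le (dir s) (N s))).1
    have h2 := le_abs_self h
    have h3 := abs_nonneg b
    have h4 := abs_nonneg h
    simp only [hL]
    push_cast
    rw [Int.toNat_of_nonneg (by omega)]
    omega
  refine ⟨n, ?_⟩
  -- Coordinate `X` carries `p` at the start of the arm `X` and is zero at all ends. Coordinate `(s,
  -- j)` lives on the arm `s` only and appears there at step `j`.
  set Y : Fin 3 → ℕ → Fin 3 ⊕ Fin 3 × Fin n → Fin σ.keyLen → ZMod 2 := fun s t =>
    Sum.elim (fun X => k (L X + s.1 + level (dir s) t))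
      (fun sj => if sj.1 = s then fr s sj.2 t else 0) with hY
  have hYarm : ∀ s t j, q.KeyStep (dir s t) (Y s t j) (Y s (t + 1) j) := by
    rintro s t (X | ⟨s', j⟩)
    · exact hk.isArm (dir s) _ t
    · simp only [hY, Sum.elim_inr]
      split_ifs
      · exact hfr s j t
      · exact .zero q _
  have harc := fun s t => (harm s t).prod (hδ.isArm (dir s) (s.1 - 1) t) (hYarm s t)
  choose μ hsrc htgt hzero using harc
  set K : Fin 3 → ℕ → Fin σ.keyLen → α × α × (Fin 3 ⊕ Fin 3 × Fin n → ZMod 2) := fun s t i =>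
    (x s t i, δ (s.1 - 1 + level (dir s) t) i, fun j => Y s t j i) with hK
  set Z : Fin 3 → Fin 3 ⊕ Fin 3 × Fin n → Term σ (ZMod 2) := fun s =>
    Sum.elim (fun X i => χ (u (L X + s.1) i)) (fun _ _ => 0) with hZ
  set C : Fin 3 → ℕ → Term σ (α × α × (Fin 3 ⊕ Fin 3 × Fin n → ZMod 2)) := fun s t =>
    Nat.casesOn t (fun i => (ctr s i, u (s.1 - 1) i, fun j => Z s j i))
      (fun t i => μ s t (q.tgt (dir s t) i)) with hC
  set O : Fin 3 → ℕ → Term σ (α × α × (Fin 3 ⊕ Fin 3 × Fin n → ZMod 2)) := fun s t i =>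
    μ s t (q.src (dir s t) i) with hO
  have hCK : ∀ s t, keyTuple (C s t) = K s t := by
    rintro s (_ | t)
    · funext i
      refine Prod.ext (congrFun (hx0 s).symm i) (Prod.ext ?_ ?_)
      · simp only [hK, level, add_zero]
        rfl
      · funext j
        rcases j with X | sj
        · simp only [hK, hY, level, add_zero, Sum.elim_inl]
          rw [hkδ _ (hLb X s)]
          rfl
        · simp only [hK, hY, Sum.elim_inr]
          split_ifs
          · rw [hfr0 s _ 0 (Nat.zero_le _)]
            rfl
          · rfl
    · exact funext fun i => htgt s t i
  have hOK : ∀ s t, keyTuple (O s t) = K s t := fun s t => funext fun i => hsrc s t i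
  have hzC : ∀ s, ∀ t (ht : t < n) i, (C s t i).2.2 (.inr (s, ⟨t, ht⟩)) = 0 := by
    rintro s (_ | t) ht i
    · rfl
    · refine hzero s t _ ?_ ?_ _
      · simp only [hY, Sum.elim_inr, if_true]
        exact hfr0 s _ t (Nat.le_succ t)
      · simp only [hY, Sum.elim_inr, if_true]
        exact hfr0 s _ (t + 1) le_rfl
  have hfresh : ∀ s, ∀ t (ht : t < n), ∃ i, (K s (t + 1) i).2.2 (.inr (s, ⟨t, ht⟩)) ≠ 0 := by
    intro s t ht
    obtain ⟨i, hi⟩ := Function.ne_iff.1 (hfr1 s t)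
    exact ⟨i, by simpa [hK, hY] using hi⟩
  -- The fresh coordinate `(s, t - 1)` is zero on the other arms and earlier on this one.
  have hsep : ∀ s, ∀ t ≤ n, ∀ s', ∀ t' ≤ n, K s t = K s' t' → 0 < t → s' = s ∧ t ≤ t' := by
    rintro s (_ | t) ht s' t' ht' he h0
    · omega
    obtain ⟨i, hi⟩ := hfresh s t (by omega)
    rw [he] at hi
    simp only [hK, hY, Sum.elim_inr] at hi
    split_ifs at hi with hs
    · subst hs
      refine ⟨rfl, ?_⟩
      by_contra hlt
      exact hi (congrFun (hfr0 _ t t' (by omega)) i)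
    · exact absurd rfl hi
  have hZsol : ∀ s s' : Fin 3, s'.1 = s.1 + 1 → ∀ j, q.Sol (Z s j) (Z s' j) := by
    rintro s s' hs (X | sj)
    · have := (hu (L X + s.1)).map χ
      rw [add_assoc] at this
      simp only [hZ, Sum.elim_inl, hs]
      exact_mod_cast this
    · exact ⟨0, rfl, rfl⟩
  exact ⟨{
    c := C
    o := O
    sol_de := hde.prod (by simpa using hu (-1)) (hZsol 0 1 rfl)
    sol_ef := hef.prod (by simpa using hu 0) (hZsol 1 2 rfl)
    not_sol_fd := fun hfd' => hfd (hfd'.map Prod.fst)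
    keyEq := fun s t _ => (hCK s t).trans (hOK s t).symm
    -- The fresh label of the next key already occurs in `O s t`, but nowhere in `C s t`.
    ne := fun s t ht he => by
      obtain ⟨i, hi⟩ := hfresh s t ht
      obtain ⟨j, hj⟩ := hq.tgt_mem (dir s t) i
      refine hi ?_
      have h1 : K s (t + 1) i = O s t j := by
        rw [← hCK]
        exact congrArg (μ s t) hj.symm
      rw [h1, ← he]
      exact hzC s t ht j
    symSol := fun s t _ => by
      simp only [hO, hC]
      generalize dir s t = e
      cases e
      · exact .inr ⟨μ s t, rfl, rfl⟩
      · exact .inl ⟨μ s t, rfl, rfl⟩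
    eq_of_keyEq := fun s t ht s' t' ht' he => by
      have he' : K s t = K s' t' := by rw [← hCK, ← hCK]; exact he
      rcases Nat.eq_zero_or_pos t with rfl | h0
      · rcases Nat.eq_zero_or_pos t' with rfl | h0'
        -- The three starts have no fresh labels; the coordinate that follows the triangle separates
        -- them.
        · refine ⟨hne s s' ?_, rfl⟩
          funext i
          have := congrArg (fun z => z.2.1) (congrFun he' i)
          simpa only [hK, level, add_zero] using this
        · have := hsep s' t' ht' s 0 ht he'.symm h0'
          omega
      · have h1 := hsep s t ht s' t' ht' he' h0
        have h2 := hsep s' t' ht' s t ht he'.symm (by omega)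
        exact ⟨h2.1, by omega⟩
    not_subset := fun s X hsub => by
      obtain ⟨i, hi⟩ := hsub ⟨ip, rfl⟩
      rw [hCK, hCK] at hi
      have := congrArg (fun z => z.2.2 (.inl X)) hi
      simp only [hK, hY, Sum.elim_inl, level, add_zero] at this
      rw [hk0 _ (hn X s), hkδ _ (hLb X X)] at this
      have hδ0 : δ (L X + X.1) = δ 0 := by
        have hp3 : Function.Periodic δ 3 := fun i => by simp only [hδdef, hper]
        have := hp3.int_mul (-(|b| + 1)) 0
        rw [← this]
        congr 1
        simp only [hL, Int.cast_id]
        ring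
      rw [hδ0] at this
      rw [Function.comp_apply, hχp] at this
      exact zero_ne_one this }⟩

end Construction

/-! ### From a tripath in a component to the contradiction -/

section Main

variable {σ : Signature} {V α : Type*} {q : Query σ V}

theorem Query.KeyReach.symm {k k' : Fin σ.keyLen → α} (h : q.KeyReach k k') :
    q.KeyReach k' k := by
  induction h with
  | refl => exact .refl
  | tail _ h ih => exact .head h.symm ih

theorem nonempty_embedding_prod (α : Type*) [Infinite α] (F : Type*) [Finite F] :
    Nonempty (α × α × F ↪ α) := by
  obtain ⟨e⟩ : Nonempty (α × α ≃ α) :=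
    Cardinal.eq.1 (by rw [Cardinal.mk_prod, Cardinal.lift_id]
                      exact Cardinal.mul_eq_self (Cardinal.aleph0_le_mk α))
  obtain ⟨n, ⟨f⟩⟩ := Finite.exists_equiv_fin F
  let g : F ↪ α := f.toEmbedding.trans
    (Fin.valEmbedding.trans (Infinite.natEmbedding α))
  exact ⟨((Function.Embedding.refl α).prodMap
    (((Function.Embedding.refl α).prodMap g).trans e.toEmbedding)).trans e.toEmbedding⟩

theorem gSet_subset (d e f : Term σ α) : gSet d e f ⊆ keySet e := by
  unfold gSet gTuple
  split_ifs with h1 h2 h3 h4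
  · exact h1.1
  · exact h2.2
  · exact h3.1.trans h3.2
  · exact h4.1.trans h4.2
  · exact subset_rfl

/-- The facts of a triangle, as a bi-infinite periodic chain. -/
def triangleLine (d e f : Term σ α) (i : ℤ) : Term σ α :=
  if i % 3 = 0 then e else if i % 3 = 1 then f else d

theorem triangleLine_sol {d e f : Term σ α} (hde : q.Sol d e) (hef : q.Sol e f)
    (hfd : q.Sol f d) (i : ℤ) : q.Sol (triangleLine d e f i) (triangleLine d e f (i + 1)) := by
  have h : i % 3 = 0 ∨ i % 3 = 1 ∨ i % 3 = 2 := by omega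
  unfold triangleLine
  rcases h with h | h | h
  · rwa [if_pos h, if_neg (by omega), if_pos (by omega)]
  · rwa [if_neg (by omega), if_pos h, if_neg (by omega), if_neg (by omega)]
  · rwa [if_neg (by omega), if_neg (by omega), if_pos (by omega)]

variable [DecidableEq α]

/-- On keys, changing the fact within a block costs nothing, so connected blocks give chains. -/
theorem Query.Connected.keyReach {D : Finset (Term σ α)} {B B' : Block D}
    (h : q.Connected D B B') :
    ∀ a ∈ B.1, ∀ b ∈ B'.1, q.KeyReach (keyTuple a) (keyTuple b) := by
  have hself : ∀ (B : Block D), ∀ a ∈ B.1, ∀ b ∈ B.1, q.KeyReach (keyTuple a) (keyTuple b) := by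
    intro B a ha b hb
    rw [show keyTuple a = keyTuple b from B.keyEq ha hb]
    exact .refl
  induction h with
  | rel B B' h =>
    obtain ⟨a', ha', b', hb', h⟩ := h
    intro a ha b hb
    exact ((hself B a ha a' ha').tail (h.imp Query.Sol.keyStep Query.Sol.keyStep)).trans
      (hself B' b' hb' b hb)
  | refl B => exact hself B
  | symm B B' _ ih => exact fun a ha b hb => (ih b hb a ha).symm
  | trans B B' B'' _ _ ih ih' =>
    intro a ha b hb
    obtain ⟨x, hx, rfl⟩ := exists_eq_blockOf B'
    exact (ih a ha x (self_mem_blockOf hx)).trans (ih' x (self_mem_blockOf hx) b hb)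

theorem Query.keyReach_of_mem_component {D : Finset (Term σ α)} {B : Block D} {a b : Term σ α}
    (ha : a ∈ q.component D B) (hb : b ∈ q.component D B) :
    q.KeyReach (keyTuple a) (keyTuple b) := by
  obtain ⟨haD, ha⟩ := Query.mem_component.1 ha
  obtain ⟨hbD, hb⟩ := Query.mem_component.1 hb
  exact Query.Connected.keyReach ((ha.symm _ _).trans _ _ _ hb) a (self_mem_blockOf haD) b
    (self_mem_blockOf hbD)

namespace Tripath

variable {Θ : Finset (Term σ α)} (T : Tripath q Θ)

theorem parent_ne_self (B : Block Θ) : T.parent B ≠ some B := by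
  intro h
  have hB : ∀ C, Relation.ReflTransGen (fun B₁ B₂ => T.parent B₁ = some B₂) B C → C = B := by
    intro C hC
    induction hC with
    | refl => rfl
    | tail _ h' ih =>
      subst ih
      exact Option.some_injective _ (h'.symm.trans h)
  have h' := (T.parent_eq_none_iff B).2 (hB _ (T.reaches_root B)).symm
  rw [h] at h'
  exact absurd h' (by simp)

theorem b_mem {B B' : Block Θ} (h : T.parent B = some B') : T.b B ∈ B.1 := by
  have hroot : B ≠ T.root := by
    rintro rfl
    rw [(T.parent_eq_none_iff _).2 rfl] at h
    exact absurd h (by simp)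
  by_cases h1 : B = T.leaf₁
  · rw [h1, T.leaf₁_facts]
    exact Finset.mem_singleton_self _
  by_cases h2 : B = T.leaf₂
  · rw [h2, T.leaf₂_facts]
    exact Finset.mem_singleton_self _
  rw [(T.inner_facts B hroot h1 h2).2]
  exact Finset.mem_insert_of_mem (Finset.mem_singleton_self _)

theorem a_root_mem : T.a T.root ∈ T.root.1 := by
  rw [T.root_facts]
  exact Finset.mem_singleton_self _

theorem a_mem {B B' : Block Θ} (h : T.parent B' = some B) : T.a B ∈ B.1 := by
  by_cases hroot : B = T.root
  · rw [hroot]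
    exact T.a_root_mem
  have hleaf : ¬ (B = T.leaf₁ ∨ B = T.leaf₂) := fun hl => (T.leaf_iff B).2 hl B' h
  rw [not_or] at hleaf
  rw [(T.inner_facts B hroot hleaf.1 hleaf.2).2]
  exact Finset.mem_insert_self _ _

end Tripath

/-- If `q` does not admit a fork-tripath, then every component that contains a tripath has only
triangles as centers. -/
theorem Query.TwoWayDetermined.sol_of_containsTripath [Infinite α] (hq : q.TwoWayDetermined)
    (hfork : ¬ q.AdmitsForkTripath α) {C : Finset (Term σ α)}
    (hC : ∀ a ∈ C, ∀ b ∈ C, q.KeyReach (keyTuple a) (keyTuple b)) (hT : q.ContainsTripath C)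
    {d e f : Term σ α} (hd : d ∈ C) (he : e ∈ C) (hf : f ∈ C) (hde : q.Sol d e)
    (hef : q.Sol e f) : q.Sol f d := by
  by_contra hfd
  obtain ⟨Θ, hΘ, ⟨T⟩⟩ := hT
  have htri : q.Sol (T.b T.childF) (T.b T.childD) := by
    by_contra h
    exact hfork ⟨C, Θ, hΘ, T, h⟩
  have hdm := T.b_mem T.parent_childD
  have hem := T.a_mem T.parent_childD
  have hfm := T.b_mem T.parent_childF
  have hne : ∀ {B B' : Block Θ} {a b : Term σ α}, a ∈ B.1 → b ∈ B'.1 → B ≠ B' → ¬ KeyEq a b := by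
    intro B B' a b ha hb hBB' h
    rw [← blockOf_eq_iff (B.mem_of_mem ha) (B'.mem_of_mem hb), ← B.eq_blockOf ha,
      ← B'.eq_blockOf hb] at h
    exact hBB' h
  have hbD : T.branch ≠ T.childD := fun h => T.parent_ne_self T.childD (by
    rw [← h]; exact h ▸ T.parent_childD)
  have hbF : T.branch ≠ T.childF := fun h => T.parent_ne_self T.childF (by
    rw [← h]; exact h ▸ T.parent_childF)
  have h1 := hne hem hdm hbD
  have h2 := hne hem hfm hbF
  have h3 := hne hdm hfm T.child_ne
  -- The only use of the non-containment conditions: the root alone provides an element lost from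
  -- the key of `e`.
  obtain ⟨p, hpg, hpr⟩ := Set.not_subset.1 T.not_subset_root
  have hp := gSet_subset _ _ _ hpg
  have hmemC : ∀ {B : Block Θ} {a : Term σ α}, a ∈ B.1 → a ∈ C := fun ha =>
    hΘ (Block.mem_of_mem _ ha)
  set u := triangleLine (T.b T.childD) (T.a T.branch) (T.b T.childF) with hu
  have hu0 : u 0 = T.a T.branch := rfl
  have hu1 : u 1 = T.b T.childF := rfl
  have hum : u (-1) = T.b T.childD := rfl
  have hctr : ∀ s : Fin 3, q.KeyReach (keyTuple ((![d, e, f] : Fin 3 → Term σ α) s))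
      (keyTuple (u 0)) := by
    intro s
    refine hC _ ?_ _ (hmemC hem)
    fin_cases s
    · exact hd
    · exact he
    · exact hf
  obtain ⟨n, ⟨F⟩⟩ := hq.exists_forkArms (u := u) (ctr := ![d, e, f])
    (triangleLine_sol T.sol_de T.sol_ef htri)
    (fun i => by simp [hu, triangleLine, Int.add_emod_right])
    (fun s s' h => by
      fin_cases s <;> fin_cases s' <;> first | rfl | exfalso
      · exact h1 h.symm
      · exact h3 h
      · exact h1 h
      · exact h2 h
      · exact h3 h.symm
      · exact h2 h.symm)
    hde hef hfd hctr (hC _ (hmemC T.a_root_mem) _ (hmemC hem)) hp hpr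
  -- The label group is finite, so the product domain fits back into `α`.
  obtain ⟨ι⟩ := nonempty_embedding_prod α (Fin 3 ⊕ Fin 3 × Fin n → ZMod 2)
  obtain ⟨F'⟩ := F.map ι ι.injective
  exact hfork F'.admitsForkTripath

end Main

end TwoAtom

theorem mainTheorem9 {σ : TwoAtom.Signature} {V α : Type*} [DecidableEq α] [Infinite α]
    (q : TwoAtom.Query σ V) (hq : q.TwoWayDetermined) (hfork : ¬ q.AdmitsForkTripath α)
    (D : Finset (TwoAtom.Term σ α)) :
    ∃ P : Finpartition D, P.parts = q.components D ∧
      (∀ C ∈ P.parts, ¬ q.ContainsTripath C ∨ q.IsCliqueDatabase C) ∧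
      (q.Certain D ↔ ∃ C ∈ P.parts, q.Certain C) ∧
      (∀ k : ℕ, ∀ C ∈ P.parts, q.Cert k C → q.Cert k D) ∧
      (q.Matching D → ∀ C ∈ P.parts, q.Matching C) := by
  refine ⟨q.componentPartition D, rfl, fun C hC => ?_, q.certain_iff D, fun k C hC h => ?_,
    fun h C hC => ?_⟩
  · by_cases hT : q.ContainsTripath C
    · right
      obtain ⟨B, -, rfl⟩ := Finset.mem_image.1 (show C ∈ q.components D from hC)
      exact TwoAtom.Query.isCliqueDatabase_of_triangles hq fun d hd e he f hf hde hef =>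
        hq.sol_of_containsTripath hfork
          (fun a ha b hb => TwoAtom.Query.keyReach_of_mem_component ha hb) hT hd he hf hde hef
    · exact .inl hT
  · exact (TwoAtom.Query.saturated_of_mem_components hC).cert h
  · exact (TwoAtom.Query.saturated_of_mem_components hC).matching h
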